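/- Let $E$ be a real Banach lattice with topological dual $E'$ and bidual $E''$; $E'$ is ordered by $f\le g\iff f(x)\le g(x)$ for all $x\ge 0$ and is itself a Banach lattice. A net is indexed by a nonempty directed preordered set. A net $(x_\alpha)$ is order null if there is a net $y_\beta\downarrow 0$ (possibly over another index set) such that for each $\beta$ there is $\alpha_0$ with $|x_\alpha|\le y_\beta$ for all $\alpha\ge\alpha_0$. A net $(x_\alpha)$ is $uo$-null (resp. $un$-null, $uaw$-null) if for every $u\ge 0$ the net $|x_\alpha|\wedge u$ is order null (resp. norm null, weakly null). A net $(x'_\alpha)$ in $E'$ is $uaw^*$-null if $|x'_\alpha|\wedge u'\to 0$ in the weak* topology $\sigma(E',E)$ for every $0\le u'\in E'$. A net is disjoint if $|x_\alpha|\wedge|x_\beta|=0$ whenever $\alpha\neq\beta$. Let $E^\sim_{uo}$ be the set of linear functionals $f$ on $E$ such that $f(x_\alpha)\to 0$ for every norm bounded $uo$-null net $(x_\alpha)$ in $E$. Let $E^\sim_{un}$ (resp. $E^\sim_{uaw}$) be the set of $f\in E'$ such that $f(x_\alpha)\to 0$ for every norm bounded $un$-null (resp. $uaw$-null) net in $E$,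 and $E^\sim_{d}$ the set of $f\in E'$ such that $f(x_\alpha)\to 0$ for every norm bounded disjoint net in $E$ whose index set has no maximal element. Let $(E')^\sim_{uaw^*}$ be the set of $f\in E''$ such that $f(x'_\alpha)\to 0$ for every norm bounded $uaw^*$-null net in $E'$. Regard $E$ as a subset of $E''$ through the canonical embedding. A Banach lattice has order continuous norm if $\|x_\alpha\|\to 0$ for every net $x_\alpha\downarrow 0$. Theorem. For every Banach lattice $E$: 1. $E$ has order continuous norm if and only if $(E')^\sim_{uaw^*}=E$. 2. $E'$ has order continuous norm if and only if $E^\sim_{uaw}=E^\sim_{d}=E^\sim_{un}=E'$. 3. Both $E$ and $E'$ have order continuous norm if and only if $E^\sim_{uo}=E^\sim_{uaw}=E^\sim_{d}=E^\sim_{un}=E'$. 4. $E$ is reflexive if and only if $(E')^\sim_{uaw^*}=(E')^\sim_{uo}=(E')^\sim_{uaw}=(E')^\sim_{d}=(E')^\sim_{un}=E''$. -/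

import Mathlib

universe u v

namespace BanachLattice

open Filter Topology

noncomputable section

/-! ### The dual of a Banach lattice, as a Banach lattice

The order on the topological dual is `f ≤ g ↔ ∀ x ≥ 0, f x ≤ g x`; it is a lattice order by the
Riesz-Kantorovich formula. -/

section Dual

set_option linter.unusedSectionVars false

variable {E : Type u} [NormedAddCommGroup E] [NormedSpace ℝ E] [Lattice E]
  [IsOrderedAddMonoid E] [HasSolidNorm E]

theorem apply_le_of_mem_Icc (f : StrongDual ℝ E) {x y : E} (hy : y ∈ Set.Icc 0 x) :
    f y ≤ ‖f‖ * ‖x‖ := by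
  have h1 : ‖y‖ ≤ ‖x‖ := by
    apply norm_le_norm_of_abs_le_abs
    rw [abs_of_nonneg hy.1, abs_of_nonneg (hy.1.trans hy.2)]
    exact hy.2
  calc f y ≤ ‖f y‖ := Real.le_norm_self _
    _ ≤ ‖f‖ * ‖y‖ := f.le_opNorm y
    _ ≤ ‖f‖ * ‖x‖ := by gcongr

/-- `x ↦ sup {f y : 0 ≤ y ≤ x}`, the positive part of `f` on the positive cone. -/
def dualPosAux (f : StrongDual ℝ E) (x : E) : ℝ := sSup (f '' Set.Icc 0 x)

theorem le_dualPosAux (f : StrongDual ℝ E) {x y : E} (hy : y ∈ Set.Icc 0 x) :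
    f y ≤ dualPosAux f x := by
  refine le_csSup ⟨‖f‖ * ‖x‖, ?_⟩ ⟨y, hy, rfl⟩
  rintro _ ⟨z, hz, rfl⟩
  exact apply_le_of_mem_Icc f hz

theorem dualPosAux_le (f : StrongDual ℝ E) {x : E} (hx : 0 ≤ x) {c : ℝ}
    (h : ∀ y ∈ Set.Icc 0 x, f y ≤ c) : dualPosAux f x ≤ c := by
  refine csSup_le ⟨f 0, 0, ⟨le_rfl, hx⟩, rfl⟩ ?_
  rintro _ ⟨z, hz, rfl⟩
  exact h z hz

theorem dualPosAux_nonneg (f : StrongDual ℝ E) {x : E} (hx : 0 ≤ x) : 0 ≤ dualPosAux f x := by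
  simpa using le_dualPosAux f (x := x) (y := 0) ⟨le_rfl, hx⟩

theorem dualPosAux_add (f : StrongDual ℝ E) {x y : E} (hx : 0 ≤ x) (hy : 0 ≤ y) :
    dualPosAux f (x + y) = dualPosAux f x + dualPosAux f y := by
  apply le_antisymm
  · refine dualPosAux_le f (add_nonneg hx hy) fun z hz => ?_
    have h1 : z ⊓ x ∈ Set.Icc 0 x := ⟨le_inf hz.1 hx, inf_le_right⟩
    have h2 : z - z ⊓ x ∈ Set.Icc 0 y := by
      refine ⟨sub_nonneg.2 inf_le_left, ?_⟩
      rw [sub_le_iff_le_add, add_comm, inf_add]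
      exact le_inf (le_add_of_nonneg_right hy) hz.2
    have := add_le_add (le_dualPosAux f h1) (le_dualPosAux f h2)
    rwa [← map_add, add_sub_cancel] at this
  · rw [← le_sub_iff_add_le]
    refine dualPosAux_le f hx fun z hz => ?_
    rw [le_sub_comm]
    refine dualPosAux_le f hy fun w hw => ?_
    rw [le_sub_iff_add_le', ← map_add]
    exact le_dualPosAux f ⟨add_nonneg hz.1 hw.1, add_le_add hz.2 hw.2⟩

/-- The positive part `f ⊔ 0` of a bounded functional. -/
def dualPos (f : StrongDual ℝ E) : StrongDual ℝ E :=
  AddMonoidHom.toRealLinearMap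
    { toFun := fun x => dualPosAux f x⁺ - dualPosAux f x⁻
      map_zero' := by simp
      map_add' := fun x y => by
        have h : (x + y)⁺ + (x⁻ + y⁻) = (x + y)⁻ + (x⁺ + y⁺) := by
          rw [← sub_eq_zero]
          have h1 := posPart_sub_negPart (x + y)
          have h2 := posPart_sub_negPart x
          have h3 := posPart_sub_negPart y
          calc (x + y)⁺ + (x⁻ + y⁻) - ((x + y)⁻ + (x⁺ + y⁺))
              = ((x + y)⁺ - (x + y)⁻) - (x⁺ - x⁻) - (y⁺ - y⁻) := by abel
            _ = 0 := by rw [h1, h2, h3]; abel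
        have h' := congrArg (dualPosAux f) h
        rw [dualPosAux_add f (posPart_nonneg _) (add_nonneg (negPart_nonneg _) (negPart_nonneg _)),
          dualPosAux_add f (negPart_nonneg _) (negPart_nonneg _),
          dualPosAux_add f (negPart_nonneg _) (add_nonneg (posPart_nonneg _) (posPart_nonneg _)),
          dualPosAux_add f (posPart_nonneg _) (posPart_nonneg _)] at h'
        linarith }
    (AddMonoidHomClass.continuous_of_bound _ ‖f‖ fun x => by
      have hp : ‖x⁺‖ ≤ ‖x‖ := norm_le_norm_of_abs_le_abs (by
        rw [abs_of_nonneg (posPart_nonneg x), ← posPart_add_negPart x]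
        exact le_add_of_nonneg_right (negPart_nonneg x))
      have hn : ‖x⁻‖ ≤ ‖x‖ := norm_le_norm_of_abs_le_abs (by
        rw [abs_of_nonneg (negPart_nonneg x), ← posPart_add_negPart x]
        exact le_add_of_nonneg_left (posPart_nonneg x))
      have h1 : dualPosAux f x⁺ ≤ ‖f‖ * ‖x‖ :=
        (dualPosAux_le f (posPart_nonneg x) fun y hy => apply_le_of_mem_Icc f hy).trans
          (by gcongr)
      have h2 : dualPosAux f x⁻ ≤ ‖f‖ * ‖x‖ :=
        (dualPosAux_le f (negPart_nonneg x) fun y hy => apply_le_of_mem_Icc f hy).trans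
          (by gcongr)
      have h3 := dualPosAux_nonneg f (posPart_nonneg x)
      have h4 := dualPosAux_nonneg f (negPart_nonneg x)
      change |dualPosAux f x⁺ - dualPosAux f x⁻| ≤ _
      rw [abs_le]
      constructor <;> linarith)

theorem dualPos_apply (f : StrongDual ℝ E) {x : E} (hx : 0 ≤ x) :
    dualPos f x = dualPosAux f x := by
  change dualPosAux f x⁺ - dualPosAux f x⁻ = _
  rw [posPart_of_nonneg hx, negPart_of_nonneg hx]
  simp [dualPosAux]

instance instPartialOrderDual : PartialOrder (StrongDual ℝ E) where
  le f g := ∀ x, 0 ≤ x → f x ≤ g x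
  le_refl f x _ := le_rfl
  le_trans f g h h1 h2 x hx := (h1 x hx).trans (h2 x hx)
  le_antisymm f g h1 h2 := by
    have h : ∀ x, 0 ≤ x → f x = g x := fun x hx => le_antisymm (h1 x hx) (h2 x hx)
    ext x
    rw [← posPart_sub_negPart x, map_sub, map_sub, h _ (posPart_nonneg x),
      h _ (negPart_nonneg x)]

theorem dual_le_iff {f g : StrongDual ℝ E} : f ≤ g ↔ ∀ x, 0 ≤ x → f x ≤ g x := Iff.rfl

instance instIsOrderedAddMonoidDual : IsOrderedAddMonoid (StrongDual ℝ E) where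
  add_le_add_left f g h k x hx := by
    simpa using h x hx

theorem le_dualPos (f : StrongDual ℝ E) : f ≤ dualPos f := fun x hx => by
  rw [dualPos_apply f hx]
  exact le_dualPosAux f ⟨hx, le_rfl⟩

theorem zero_le_dualPos (f : StrongDual ℝ E) : 0 ≤ dualPos f := fun x hx => by
  rw [dualPos_apply f hx]
  exact dualPosAux_nonneg f hx

theorem dualPos_le {f g : StrongDual ℝ E} (h : f ≤ g) (h0 : 0 ≤ g) : dualPos f ≤ g :=
  fun x hx => by
    rw [dualPos_apply f hx]
    refine dualPosAux_le f hx fun y hy => (h y hy.1).trans ?_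
    have := h0 (x - y) (sub_nonneg.2 hy.2)
    simpa using this

instance instLatticeDual : Lattice (StrongDual ℝ E) where
  sup f g := g + dualPos (f - g)
  inf f g := f - dualPos (f - g)
  le_sup_left f g := sub_le_iff_le_add'.1 (le_dualPos (f - g))
  le_sup_right f g := le_add_of_nonneg_right (zero_le_dualPos (f - g))
  sup_le f g h h1 h2 := by
    rw [← le_sub_iff_add_le']
    exact dualPos_le (sub_le_sub_right h1 g) (sub_nonneg.2 h2)
  inf_le_left f g := sub_le_self f (zero_le_dualPos (f - g))
  inf_le_right f g := sub_le_comm.1 (le_dualPos (f - g))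
  le_inf h f g h1 h2 := by
    rw [le_sub_comm]
    exact dualPos_le (sub_le_sub_left h2 f) (sub_nonneg.2 h1)

instance instIsOrderedModuleDual : IsOrderedModule ℝ (StrongDual ℝ E) :=
  IsOrderedModule.of_smul_nonneg fun (c : ℝ) hc (f : StrongDual ℝ E) hf => by
    intro x hx
    have h := mul_nonneg hc (dual_le_iff.1 hf x hx)
    simpa using h

theorem dual_apply_le_abs (f : StrongDual ℝ E) {x : E} (hx : 0 ≤ x) : |f x| ≤ |f| x := by
  rw [abs_le']
  exact ⟨le_abs_self f x hx, neg_le_abs f x hx⟩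

theorem dual_abs_apply_le (f : StrongDual ℝ E) (x : E) : |f x| ≤ |f| |x| := by
  have h1 := abs_le.1 (dual_apply_le_abs f (posPart_nonneg x))
  have h2 := abs_le.1 (dual_apply_le_abs f (negPart_nonneg x))
  rw [← posPart_add_negPart x, map_add]
  conv_lhs => rw [← posPart_sub_negPart x, map_sub]
  rw [abs_le]
  constructor <;> linarith [h1.1, h1.2, h2.1, h2.2]

theorem dual_abs_apply_le_norm (f : StrongDual ℝ E) {x : E} (hx : 0 ≤ x) :
    |f| x ≤ ‖f‖ * ‖x‖ := by
  have h : |f| x = -f x + dualPosAux (f - -f) x := by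
    rw [← dualPos_apply _ hx]; rfl
  rw [h, ← le_sub_iff_add_le']
  refine dualPosAux_le _ hx fun y hy => ?_
  have h1 : |y - (x - y)| ≤ |x| := by
    rw [abs_of_nonneg hx]
    refine abs_le'.2 ⟨?_, ?_⟩
    · exact (sub_le_self _ (sub_nonneg.2 hy.2)).trans hy.2
    · rw [neg_sub]
      exact (sub_le_self _ hy.1).trans (sub_le_self _ hy.1)
  have h2 : f (y - (x - y)) ≤ ‖f‖ * ‖x‖ :=
    (Real.le_norm_self _).trans ((f.le_opNorm _).trans
      (mul_le_mul_of_nonneg_left (norm_le_norm_of_abs_le_abs h1) (norm_nonneg f)))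
  simp only [map_sub] at h2
  simp only [sub_neg_eq_add, add_apply]
  linarith

instance instHasSolidNormDual : HasSolidNorm (StrongDual ℝ E) where
  solid f g h := by
    refine f.opNorm_le_bound (norm_nonneg g) fun x => ?_
    calc ‖f x‖ = |f x| := Real.norm_eq_abs _
      _ ≤ |f| |x| := dual_abs_apply_le f x
      _ ≤ |g| |x| := h _ (abs_nonneg x)
      _ ≤ ‖g‖ * ‖|x|‖ := dual_abs_apply_le_norm g (abs_nonneg x)
      _ = ‖g‖ * ‖x‖ := by rw [norm_abs_eq_norm]

end Dual

/-! ### Convergence of nets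

A net is a family indexed by a nonempty directed (pre)ordered set. -/

section Nets

variable {E : Type u} [NormedAddCommGroup E] [NormedSpace ℝ E] [Lattice E]

/-- `y ↓ 0`: the net `y` is decreasing with infimum `0`. -/
def DecreasesToZero {β : Type v} [Preorder β] (y : β → E) : Prop :=
  Antitone y ∧ IsGLB (Set.range y) 0

/-- The net `x` is order convergent to `0`; the dominating net may have another index set. -/
def OrderNull {ι : Type v} [Preorder ι] (x : ι → E) : Prop :=
  ∃ (β : Type u) (_ : Preorder β) (_ : IsDirectedOrder β) (_ : Nonempty β) (y : β → E),
    DecreasesToZero y ∧ ∀ b, ∃ a₀, ∀ a ≥ a₀, |x a| ≤ y b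

/-- The net `x` is weakly null. -/
def WeaklyNull {ι : Type v} [Preorder ι] (x : ι → E) : Prop :=
  ∀ f : StrongDual ℝ E, Tendsto (fun a => f (x a)) atTop (𝓝 0)

/-- The net `x` in the dual is weak* null. -/
def WeakStarNull {ι : Type v} [Preorder ι] (x : ι → StrongDual ℝ E) : Prop :=
  ∀ e : E, Tendsto (fun a => x a e) atTop (𝓝 0)

/-- `x` is `uo`-null. -/
def UoNull {ι : Type v} [Preorder ι] (x : ι → E) : Prop :=
  ∀ w : E, 0 ≤ w → OrderNull fun a => |x a| ⊓ w

/-- `x` is `un`-null. -/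
def UnNull {ι : Type v} [Preorder ι] (x : ι → E) : Prop :=
  ∀ w : E, 0 ≤ w → Tendsto (fun a => |x a| ⊓ w) atTop (𝓝 0)

/-- `x` is `uaw`-null. -/
def UawNull {ι : Type v} [Preorder ι] (x : ι → E) : Prop :=
  ∀ w : E, 0 ≤ w → WeaklyNull fun a => |x a| ⊓ w

/-- The net `x` in the dual is `uaw*`-null. -/
def UawStarNull [IsOrderedAddMonoid E] [HasSolidNorm E] {ι : Type v} [Preorder ι]
    (x : ι → StrongDual ℝ E) : Prop :=
  ∀ w : StrongDual ℝ E, 0 ≤ w → WeakStarNull fun a => |x a| ⊓ w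

/-- The family `x` is disjoint. -/
def DisjointNet {ι : Type v} (x : ι → E) : Prop :=
  ∀ a b, a ≠ b → |x a| ⊓ |x b| = 0

/-- The family `x` is norm bounded. -/
def NormBoundedNet {ι : Type v} (x : ι → E) : Prop :=
  ∃ M : ℝ, ∀ a, ‖x a‖ ≤ M

end Nets

/-! ### Duals

All duals are sets of linear functionals on `E`, so that they can be compared with each other. -/

section Duals

variable (E : Type u) [NormedAddCommGroup E] [NormedSpace ℝ E] [Lattice E]

/-- The topological dual `E'`, inside the algebraic dual. -/
def boundedDual : Set (E →ₗ[ℝ] ℝ) := {f | Continuous f}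

/-- The unbounded order dual. Continuity of `f` is not part of the definition. -/
def uoDual : Set (E →ₗ[ℝ] ℝ) :=
  {f | ∀ (ι : Type u) [Preorder ι] [IsDirectedOrder ι] [Nonempty ι] (x : ι → E),
    NormBoundedNet x → UoNull x → Tendsto (fun a => f (x a)) atTop (𝓝 0)}

/-- The unbounded norm dual. -/
def unDual : Set (E →ₗ[ℝ] ℝ) :=
  {f | Continuous f ∧
    ∀ (ι : Type u) [Preorder ι] [IsDirectedOrder ι] [Nonempty ι] (x : ι → E),
      NormBoundedNet x → UnNull x → Tendsto (fun a => f (x a)) atTop (𝓝 0)}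

/-- The unbounded absolute weak dual. -/
def uawDual : Set (E →ₗ[ℝ] ℝ) :=
  {f | Continuous f ∧
    ∀ (ι : Type u) [Preorder ι] [IsDirectedOrder ι] [Nonempty ι] (x : ι → E),
      NormBoundedNet x → UawNull x → Tendsto (fun a => f (x a)) atTop (𝓝 0)}

/-- The disjoint dual. The index set must have no maximal element: otherwise every vector would be
the limit of a disjoint net (indexed by one point, say) and this dual would always be zero. -/
def dDual : Set (E →ₗ[ℝ] ℝ) :=
  {f | Continuous f ∧
    ∀ (ι : Type u) [Preorder ι] [IsDirectedOrder ι] [Nonempty ι] [NoMaxOrder ι] (x : ι → E),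
      NormBoundedNet x → DisjointNet x → Tendsto (fun a => f (x a)) atTop (𝓝 0)}

/-- The unbounded absolute weak* dual `(E')^∼_{uaw*}`, a set of functionals on `E'`. -/
def uawStarDual [IsOrderedAddMonoid E] [HasSolidNorm E] : Set (StrongDual ℝ E →ₗ[ℝ] ℝ) :=
  {f | Continuous f ∧
    ∀ (ι : Type u) [Preorder ι] [IsDirectedOrder ι] [Nonempty ι] (x : ι → StrongDual ℝ E),
      NormBoundedNet x → UawStarNull x → Tendsto (fun a => f (x a)) atTop (𝓝 0)}

/-- The canonical copy of `E` in `E''`: the evaluation functionals `f ↦ f x`. -/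
def canonicalImage : Set (StrongDual ℝ E →ₗ[ℝ] ℝ) :=
  Set.range fun x : E => (NormedSpace.inclusionInDoubleDual ℝ E x).toLinearMap

/-- The norm of `E` is order continuous. -/
def OrderContinuousNorm : Prop :=
  ∀ (ι : Type u) [Preorder ι] [IsDirectedOrder ι] [Nonempty ι] (x : ι → E),
    DecreasesToZero x → Tendsto (fun a => ‖x a‖) atTop (𝓝 0)

/-- `E` is reflexive: the canonical embedding `E → E''` is onto. -/
def IsReflexiveSpace : Prop :=
  Function.Surjective (NormedSpace.inclusionInDoubleDual ℝ E)

end Duals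

end

end BanachLattice

namespace BanachLattice

open Filter Topology

noncomputable section

set_option linter.unusedSectionVars false

/-! ### Vector lattice inequalities -/

section Riesz

variable {E : Type u} [AddCommGroup E] [Module ℝ E] [Lattice E] [IsOrderedAddMonoid E]
  [IsOrderedModule ℝ E]

/-! Order continuity of the norm is used in a quantitative form: on each interval `[0, x]` the norm
is at most `p + ε` for a single positive functional `p`
(`OrderContinuousNorm.exists_norm_le_apply_add`, with converse
`orderContinuousNorm_of_norm_le_apply_add`). For the norm of `E'` the functional `p` can be taken
from the positive cone of `E`, and the criterion becomes `UnitBallAlmostOrderBounded`: for a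
suitable `w`, `f (x - w)⁺ ≤ ε` on the positive unit ball.

Convergence along bounded nets then comes from `|x_a| = |x_a| ⊓ w + (|x_a| - w)⁺`: unbounded
convergence handles the first term, and the second is uniformly small. If the criterion fails,
counterexamples `x_w` indexed by the positive cone itself give the bounded net `(x_w - w)⁺`. It is
unbounded null because `n • ((a - n • w)⁺ ⊓ w) ≤ a`, yet a fixed functional stays above `ε` on it.

A member of the uaw* dual is, by a net of the same kind, small on those `g` in the unit ball with
`|g| x ≤ 1`. Hence its positive and negative parts are within `ε` of intervals `[0, c • x]` of
`E''`. When the norm of `E` is order continuous, `E` is an ideal of `E''`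
(`OrderContinuousNorm.exists_inclusionInDoubleDual_eq`), so these intervals lie in `E`, and `E` is
norm closed.

For the uo dual, order continuity turns order null nets into norm null ones; conversely a net
decreasing to zero is uo-null, hence weakly null, hence norm null by a Dini argument. Reflexivity
passes to duals and forces order continuity, so the last equivalence reduces to the first for `E`
and the third for `E'`. -/

theorem smul_sup_of_nonneg {c : ℝ} (hc : 0 ≤ c) (x y : E) : c • (x ⊔ y) = c • x ⊔ c • y := by
  rcases hc.eq_or_lt with rfl | hc
  · simp
  · apply le_antisymm
    · rw [← le_inv_smul_iff_of_pos hc]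
      refine sup_le ?_ ?_
      · rw [le_inv_smul_iff_of_pos hc]; exact le_sup_left
      · rw [le_inv_smul_iff_of_pos hc]; exact le_sup_right
    · exact sup_le (smul_le_smul_of_nonneg_left le_sup_left hc.le)
        (smul_le_smul_of_nonneg_left le_sup_right hc.le)

theorem posPart_smul_of_nonneg {c : ℝ} (hc : 0 ≤ c) (x : E) : (c • x)⁺ = c • x⁺ := by
  simp only [posPart_def]
  rw [smul_sup_of_nonneg hc, smul_zero]

theorem posPart_add_le (x y : E) : (x + y)⁺ ≤ x⁺ + y⁺ :=
  sup_le (add_le_add (le_posPart x) (le_posPart y))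
    (add_nonneg (posPart_nonneg x) (posPart_nonneg y))

/-- `n • ((a - n • w)⁺ ⊓ w) ≤ a`. -/
theorem smul_posPart_sub_inf_le {a w : E} (ha : 0 ≤ a) {n : ℝ} (hn : 1 ≤ n) :
    n • ((a - n • w)⁺ ⊓ w) ≤ a := by
  have hn0 : 0 ≤ n := zero_le_one.trans hn
  set v := a - n • w with hv
  set z := n • (v⁺ ⊓ w)
  have h1 : z ≤ n • v⁺ := smul_le_smul_of_nonneg_left inf_le_left hn0
  have h2 : z ≤ a - v := by
    rw [hv, sub_sub_cancel]; exact smul_le_smul_of_nonneg_left inf_le_right hn0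
  have h3 : a - v ≤ a + v⁻ := by
    rw [sub_eq_add_neg]
    gcongr
    exact neg_le_negPart v
  have h4 : z - a ≤ n • v⁻ := by
    calc z - a ≤ v⁻ := sub_le_iff_le_add'.2 (h2.trans h3)
      _ = (1 : ℝ) • v⁻ := (one_smul _ _).symm
      _ ≤ n • v⁻ := smul_le_smul_of_nonneg_right hn (negPart_nonneg v)
  have h5 : z - a ≤ n • v⁺ := (sub_le_self _ ha).trans h1
  have hpos : 0 < n := zero_lt_one.trans_le hn
  -- `n⁻¹ • (z - a)` lies below both `v⁺` and `v⁻`, which are disjoint.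
  have h6 : n⁻¹ • (z - a) ≤ 0 := by
    rw [← posPart_inf_negPart_eq_zero v]
    refine le_inf ?_ ?_
    · rwa [inv_smul_le_iff_of_pos hpos]
    · rwa [inv_smul_le_iff_of_pos hpos]
  rw [inv_smul_le_iff_of_pos hpos, smul_zero] at h6
  exact sub_nonpos.1 h6

end Riesz

/-! ### Positive functionals and the Riesz-Kantorovich formula -/

section Functionals

variable {E : Type u} [NormedAddCommGroup E] [NormedSpace ℝ E] [Lattice E]
  [IsOrderedAddMonoid E] [HasSolidNorm E]

theorem norm_le_norm_of_le {x y : E} (hx : 0 ≤ x) (h : x ≤ y) : ‖x‖ ≤ ‖y‖ :=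
  norm_le_norm_of_abs_le_abs (by rwa [abs_of_nonneg hx, abs_of_nonneg (hx.trans h)])

theorem norm_posPart_le (x : E) : ‖x⁺‖ ≤ ‖x‖ :=
  (norm_le_norm_of_le (posPart_nonneg x)
    (sup_le (le_abs_self x) (abs_nonneg x))).trans_eq (norm_abs_eq_norm x)

theorem dual_nonneg {f : StrongDual ℝ E} (hf : 0 ≤ f) {x : E} (hx : 0 ≤ x) : 0 ≤ f x := by
  simpa using hf x hx

theorem dual_mono {f : StrongDual ℝ E} (hf : 0 ≤ f) {x y : E} (h : x ≤ y) : f x ≤ f y := by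
  have := dual_nonneg hf (sub_nonneg.2 h)
  rw [map_sub] at this
  linarith

theorem dual_apply_le_norm {f : StrongDual ℝ E} (hf : ‖f‖ ≤ 1) (x : E) : f x ≤ ‖x‖ :=
  (Real.le_norm_self _).trans ((f.le_opNorm x).trans
    (mul_le_of_le_one_left (norm_nonneg x) hf))

theorem dual_posPart_apply (f : StrongDual ℝ E) {x : E} (hx : 0 ≤ x) :
    f⁺ x = dualPosAux f x := by
  have h : f⁺ = 0 + dualPos (f - 0) := rfl
  rw [h, zero_add, sub_zero, dualPos_apply f hx]

theorem dual_posPart_apply_le (f : StrongDual ℝ E) {x : E} (hx : 0 ≤ x) {c : ℝ}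
    (h : ∀ y ∈ Set.Icc 0 x, f y ≤ c) : f⁺ x ≤ c := by
  rw [dual_posPart_apply f hx]
  exact dualPosAux_le f hx h

theorem exists_lt_apply_of_lt_dual_posPart (f : StrongDual ℝ E) {x : E} (hx : 0 ≤ x) {c : ℝ}
    (h : c < f⁺ x) : ∃ y ∈ Set.Icc 0 x, c < f y := by
  by_contra! hc
  exact h.not_ge (dual_posPart_apply_le f hx hc)

theorem exists_nonneg_lt_apply_of_lt_norm {f : StrongDual ℝ E} (hf : 0 ≤ f) {c : ℝ}
    (hc : c < ‖f‖) : ∃ x : E, 0 ≤ x ∧ ‖x‖ ≤ 1 ∧ c < f x := by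
  obtain ⟨x, hx, hcx⟩ := f.exists_lt_apply_of_lt_opNorm hc
  refine ⟨|x|, abs_nonneg x, by rw [norm_abs_eq_norm]; exact hx.le, hcx.trans_le ?_⟩
  have := dual_abs_apply_le f x
  rwa [abs_of_nonneg hf] at this

theorem dual_norm_le_of_nonneg {f : StrongDual ℝ E} (hf : 0 ≤ f) {c : ℝ}
    (h : ∀ x : E, 0 ≤ x → ‖x‖ ≤ 1 → f x ≤ c) : ‖f‖ ≤ c := by
  by_contra! hc
  obtain ⟨x, hx, hx1, hx2⟩ := exists_nonneg_lt_apply_of_lt_norm hf hc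
  exact hx2.not_ge (h x hx hx1)

theorem exists_nonneg_norming {y : E} (hy : 0 ≤ y) :
    ∃ f : StrongDual ℝ E, 0 ≤ f ∧ ‖f‖ ≤ 1 ∧ f y = ‖y‖ := by
  obtain ⟨g, hg, hgy⟩ := exists_dual_vector'' ℝ y
  have hg' : ‖|g|‖ ≤ 1 := by rwa [norm_abs_eq_norm]
  refine ⟨|g|, abs_nonneg g, hg', le_antisymm (dual_apply_le_norm hg' y) ?_⟩
  have : g y = ‖y‖ := hgy
  rw [← this]
  exact le_abs_self g y hy

variable [IsOrderedModule ℝ E]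

/-- Riesz-Kantorovich formula, with the supremum attained. -/
theorem exists_dual_apply_eq_posPart {f : StrongDual ℝ E} (hf : 0 ≤ f) (x : E) :
    ∃ g : StrongDual ℝ E, 0 ≤ g ∧ g ≤ f ∧ g x = f x⁺ := by
  by_cases hx : x = 0
  · exact ⟨0, le_rfl, hf, by simp [hx]⟩
  -- Hahn-Banach with the sublinear majorant `z ↦ f z⁺`: evaluated on negative vectors it forces `0
  -- ≤ g`, on positive vectors `g ≤ f`.
  obtain ⟨g, hg1, hg2⟩ := exists_extension_of_le_sublinear
    (LinearPMap.mkSpanSingleton x (f x⁺) hx) (fun z => f z⁺)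
    (fun c hc z => by rw [posPart_smul_of_nonneg hc.le, map_smul, smul_eq_mul])
    (fun z w => by rw [← map_add]; exact dual_mono hf (posPart_add_le z w))
    (by
      rintro ⟨z, hz⟩
      obtain ⟨c, rfl⟩ := Submodule.mem_span_singleton.1 hz
      refine (LinearPMap.mkSpanSingleton'_apply x (f x⁺) _ c hz).trans_le ?_
      change c * f x⁺ ≤ f (c • x)⁺
      rcases le_total 0 c with hc | hc
      · rw [posPart_smul_of_nonneg hc, map_smul, smul_eq_mul]
      · exact (mul_nonpos_of_nonpos_of_nonneg hc (dual_nonneg hf (posPart_nonneg x))).trans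
          (dual_nonneg hf (posPart_nonneg _)))
  have hb (z : E) : g z ≤ ‖f‖ * ‖z‖ := (hg2 z).trans ((Real.le_norm_self _).trans
    ((f.le_opNorm _).trans (by gcongr; exact norm_posPart_le z)))
  let g' : StrongDual ℝ E := g.mkContinuous ‖f‖ fun z => by
    rw [Real.norm_eq_abs, abs_le']
    refine ⟨hb z, ?_⟩
    rw [← map_neg, ← norm_neg z]
    exact hb _
  refine ⟨g', ?_, ?_, ?_⟩
  · intro z hz
    have := hg2 (-z)
    rw [posPart_of_nonpos (neg_nonpos.2 hz), map_zero, map_neg] at this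
    change 0 ≤ g z
    linarith
  · intro z hz
    have := hg2 z
    rwa [posPart_of_nonneg hz] at this
  · exact (hg1 ⟨x, Submodule.mem_span_singleton_self x⟩).trans
      (LinearPMap.mkSpanSingleton'_apply_self x (f x⁺) _ _)

/-- A functional norming `z⁻` can be cut down to some `g ≥ 0` with `g (-z) = ‖z⁻‖`, so `0 ≤ g z`
leaves no room for `z⁻ ≠ 0`. -/
theorem nonneg_of_forall_dual_nonneg {z : E}
    (h : ∀ f : StrongDual ℝ E, 0 ≤ f → 0 ≤ f z) : 0 ≤ z := by
  obtain ⟨f, hf, -, hfz⟩ := exists_nonneg_norming (negPart_nonneg z)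
  obtain ⟨g, hg, -, hgz⟩ := exists_dual_apply_eq_posPart hf (-z)
  rw [posPart_neg, hfz, map_neg] at hgz
  have h1 := h g hg
  have h2 := norm_nonneg z⁻
  have h3 : z⁻ = 0 := norm_eq_zero.1 (by linarith)
  exact negPart_eq_zero.1 h3

theorem le_of_forall_dual_le {x y : E}
    (h : ∀ f : StrongDual ℝ E, 0 ≤ f → f x ≤ f y) : x ≤ y := by
  rw [← sub_nonneg]
  refine nonneg_of_forall_dual_nonneg fun f hf => ?_
  rw [map_sub]
  linarith [h f hf]

end Functionals

/-! ### Order continuous norms -/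

section OrderContinuous

variable {E : Type u} [NormedAddCommGroup E] [NormedSpace ℝ E] [Lattice E]
  [IsOrderedAddMonoid E] [HasSolidNorm E]

/-- The differences "upper bound minus element of `S`" form a net decreasing to zero. Order
continuity makes them small in norm, which squeezes a Cauchy sequence out of `S`. -/
theorem OrderContinuousNorm.exists_isLUB [CompleteSpace E] (h : OrderContinuousNorm E) {S : Set E}
    (hne : S.Nonempty) (hdir : DirectedOn (· ≤ ·) S) (hb : BddAbove S) :
    ∃ s, IsLUB S s ∧ s ∈ closure S := by
  obtain ⟨a₀, ha₀⟩ := hne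
  obtain ⟨y₀, hy₀⟩ := hb
  let ι := ↥S × (↥(upperBounds S))ᵒᵈ
  let d : ι → E := fun i => (OrderDual.ofDual i.2 : ↥(upperBounds S)).1 - i.1.1
  have : Nonempty ι := ⟨⟨⟨a₀, ha₀⟩, OrderDual.toDual ⟨y₀, hy₀⟩⟩⟩
  have : IsDirectedOrder ι := ⟨by
    rintro ⟨⟨a, ha⟩, ⟨y, hy⟩⟩ ⟨⟨b, hb⟩, ⟨z, hz⟩⟩
    obtain ⟨c, hc, hac, hbc⟩ := hdir a ha b hb
    exact ⟨⟨⟨c, hc⟩, OrderDual.toDual ⟨y ⊓ z, fun e he => le_inf (hy he) (hz he)⟩⟩,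
      ⟨hac, (inf_le_left : y ⊓ z ≤ y)⟩, ⟨hbc, (inf_le_right : y ⊓ z ≤ z)⟩⟩⟩
  have hd : DecreasesToZero d := by
    refine ⟨fun i j hij => sub_le_sub hij.2 hij.1, ?_, ?_⟩
    · rintro _ ⟨i, rfl⟩
      exact sub_nonneg.2 ((OrderDual.ofDual i.2).2 i.1.2)
    · intro z hz
      -- A lower bound `z` of all differences can be subtracted from any upper bound again and
      -- again, so `n • z⁺ ≤ y₀ - a₀` for every `n`; comparing norms gives `z⁺ = 0`.
      have key : ∀ n : ℕ, ∀ y ∈ upperBounds S, y - n • z⁺ ∈ upperBounds S := by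
        intro n
        induction n with
        | zero => intro y hy; simpa using hy
        | succ n ih =>
          intro y hy a ha
          have h1 := ih y hy
          have h2 : z⁺ ≤ y - n • z⁺ - a := sup_le
            (hz ⟨(⟨⟨a, ha⟩, OrderDual.toDual ⟨_, h1⟩⟩ : ι), rfl⟩) (sub_nonneg.2 (h1 ha))
          rw [succ_nsmul, ← sub_sub]
          exact le_sub_comm.1 h2
      have h3 : ∀ n : ℕ, n * ‖z⁺‖ ≤ ‖y₀ - a₀‖ := fun n => by
        have h4 : n • z⁺ ≤ y₀ - a₀ := le_sub_comm.1 (key n y₀ hy₀ ha₀)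
        have h5 := norm_le_norm_of_le (nsmul_nonneg (posPart_nonneg z) n) h4
        rwa [← Nat.cast_smul_eq_nsmul ℝ, norm_smul, Real.norm_natCast] at h5
      have h6 : z⁺ = 0 := by
        by_contra hz0
        have hpos : 0 < ‖z⁺‖ := norm_pos_iff.2 hz0
        obtain ⟨n, hn⟩ := exists_nat_gt (‖y₀ - a₀‖ / ‖z⁺‖)
        rw [div_lt_iff₀ hpos] at hn
        exact (h3 n).not_gt hn
      exact posPart_eq_zero.1 h6
  have hlim := h ι d hd
  have hsmall : ∀ ε : ℝ, 0 < ε → ∃ a ∈ S, ∃ y ∈ upperBounds S, ‖y - a‖ < ε := fun ε hε => by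
    obtain ⟨i, hi⟩ := (hlim.eventually (gt_mem_nhds hε)).exists
    exact ⟨i.1.1, i.1.2, _, (OrderDual.ofDual i.2).2, hi⟩
  choose a ha y hy hay using fun n : ℕ => hsmall ((1 / 2) ^ n) (by positivity)
  have hle : ∀ n, ∀ c ∈ S, a n ≤ c → ‖c - a n‖ ≤ (1 / 2) ^ n := fun n c hc hac =>
    (norm_le_norm_of_le (sub_nonneg.2 hac) (sub_le_sub_right (hy n hc) _)).trans (hay n).le
  have hcau : CauchySeq a := by
    refine cauchySeq_of_le_geometric (1 / 2) 2 (by norm_num) fun n => ?_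
    obtain ⟨c, hc, h1, h2⟩ := hdir _ (ha n) _ (ha (n + 1))
    calc dist (a n) (a (n + 1)) ≤ dist (a n) c + dist c (a (n + 1)) := dist_triangle _ _ _
      _ = ‖c - a n‖ + ‖c - a (n + 1)‖ := by rw [dist_comm, dist_eq_norm, dist_eq_norm]
      _ ≤ (1 / 2) ^ n + (1 / 2) ^ (n + 1) := add_le_add (hle n c hc h1) (hle _ c hc h2)
      _ ≤ 2 * (1 / 2) ^ n := by
        rw [pow_succ]
        have : (0 : ℝ) ≤ (1 / 2) ^ n := by positivity
        linarith
  obtain ⟨s, hs⟩ := cauchySeq_tendsto_of_complete hcau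
  have hys : Tendsto y atTop (𝓝 s) := by
    have h0 : Tendsto (fun n => y n - a n) atTop (𝓝 0) :=
      squeeze_zero_norm (fun n => (hay n).le)
        (tendsto_pow_atTop_nhds_zero_of_lt_one (by norm_num) (by norm_num))
    simpa using h0.add hs
  refine ⟨s, ⟨fun c hc => ge_of_tendsto' hys fun n => hy n hc,
    fun z hz => le_of_tendsto' hs fun n => hz (ha n)⟩, ?_⟩
  exact mem_closure_of_tendsto hs (Eventually.of_forall ha)

/-- A limit superior of an order bounded sequence, together with the dominating tails. -/
theorem OrderContinuousNorm.exists_limsup [CompleteSpace E] (h : OrderContinuousNorm E) {x : E}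
    {y : ℕ → E} (hy : ∀ n, y n ∈ Set.Icc 0 x) :
    ∃ (σ : ℕ → E) (s : E), (∀ n, y n ≤ σ n) ∧ s ∈ Set.Icc 0 x ∧ (∀ n, s ≤ σ n) ∧
      Tendsto σ atTop (𝓝 s) ∧
      ∀ f : StrongDual ℝ E, 0 ≤ f → ∀ (C : ℝ) (N : ℕ),
        (∀ n ≥ N, f (y n) ≤ C * (1 / 2) ^ n) → f s = 0 := by
  let S : ℕ → Set E := fun n => Set.range fun m => partialSups (fun k => y (n + k)) m
  have hSx : ∀ n, x ∈ upperBounds (S n) := by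
    rintro n _ ⟨m, rfl⟩
    exact partialSups_le _ _ _ fun k _ => (hy _).2
  choose σ hσ hσc using fun n => h.exists_isLUB (S := S n) ⟨_, 0, rfl⟩
    (directedOn_range.2 (Monotone.directed_le (partialSups_monotone _))) ⟨x, hSx n⟩
  have hyσ : ∀ n m, n ≤ m → y m ≤ σ n := by
    intro n m hnm
    obtain ⟨k, rfl⟩ := Nat.exists_eq_add_of_le hnm
    exact (le_partialSups (fun k => y (n + k)) k).trans ((hσ n).1 ⟨k, rfl⟩)
  have hanti : Antitone σ := antitone_nat_of_succ_le fun n => (hσ (n + 1)).2 (by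
    rintro _ ⟨m, rfl⟩
    exact partialSups_le _ _ _ fun k _ => hyσ n _ (by omega))
  have hσx : ∀ n, σ n ≤ x := fun n => (hσ n).2 (hSx n)
  have hσ0 : ∀ n, 0 ≤ σ n := fun n => (hy n).1.trans (hyσ n n le_rfl)
  obtain ⟨t, ht, htc⟩ := h.exists_isLUB (S := Set.range fun n => x - σ n) ⟨_, 0, rfl⟩
    (directedOn_range.2 (Monotone.directed_le fun n m hnm => sub_le_sub_left (hanti hnm) x))
    ⟨x, by rintro _ ⟨n, rfl⟩; exact sub_le_self _ (hσ0 n)⟩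
  have hsσ : ∀ n, x - t ≤ σ n := fun n => by
    have := ht.1 ⟨n, rfl⟩
    exact sub_le_comm.1 this
  have hs0 : 0 ≤ x - t := sub_nonneg.2 (ht.2 (by
    rintro _ ⟨n, rfl⟩; exact sub_le_self _ (hσ0 n)))
  refine ⟨σ, x - t, fun n => hyσ n n le_rfl, ⟨hs0, (hsσ 0).trans (hσx 0)⟩, hsσ, ?_, ?_⟩
  · rw [Metric.tendsto_atTop]
    intro ε hε
    obtain ⟨N, hN⟩ := Metric.mem_closure_range_iff.1 htc ε hε
    refine ⟨N, fun n hn => ?_⟩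
    rw [dist_eq_norm] at hN ⊢
    refine lt_of_le_of_lt ?_ hN
    have h1 : t - (x - σ N) = σ N - (x - t) := by abel
    rw [h1]
    exact norm_le_norm_of_le (sub_nonneg.2 (hsσ n)) (sub_le_sub_right (hanti hn) _)
  · intro f hf C N hC
    have hσC : ∀ n ≥ N, f (σ n) ≤ 2 * C * (1 / 2) ^ n := by
      intro n hn
      have hcl : IsClosed {z : E | f z ≤ 2 * C * (1 / 2) ^ n} :=
        isClosed_le f.continuous continuous_const
      have hC0 : 0 ≤ C := by
        have h1 := (dual_nonneg hf (hy n).1).trans (hC n hn)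
        exact nonneg_of_mul_nonneg_left h1 (by positivity)
      refine closure_minimal ?_ hcl (hσc n)
      rintro _ ⟨m, rfl⟩
      -- The bound is the finite geometric sum `C * ∑ (1 / 2) ^ k` over `n ≤ k ≤ n + m`; the
      -- subtracted term is the remaining tail, which lets the induction close.
      have h2 : f (partialSups (fun k => y (n + k)) m)
          ≤ 2 * C * (1 / 2) ^ n - C * (1 / 2) ^ (n + m) := by
        induction m with
        | zero =>
          have := hC n hn
          simp only [partialSups_zero, add_zero]
          linarith
        | succ m ih =>
          rw [partialSups_add_one]
          have h3 : partialSups (fun k => y (n + k)) m ⊔ y (n + (m + 1))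
              ≤ partialSups (fun k => y (n + k)) m + y (n + (m + 1)) :=
            sup_le (le_add_of_nonneg_right (hy _).1)
              (le_add_of_nonneg_left ((hy n).1.trans
                (le_partialSups_of_le (fun k => y (n + k)) (Nat.zero_le m))))
          have h4 := dual_mono hf h3
          rw [map_add] at h4
          have h5 := hC (n + (m + 1)) (by omega)
          have h6 : (1 / 2 : ℝ) ^ (n + (m + 1)) = (1 / 2) ^ (n + m) / 2 := by
            rw [← add_assoc, pow_succ]; ring
          rw [h6] at h5 ⊢
          linarith
      have h7 : 0 ≤ C * (1 / 2) ^ (n + m) := by positivity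
      change f (partialSups (fun k => y (n + k)) m) ≤ _
      linarith
    refine le_antisymm ?_ (dual_nonneg hf hs0)
    have hlim : Tendsto (fun n : ℕ => 2 * C * (1 / 2 : ℝ) ^ n) atTop (𝓝 (2 * C * 0)) :=
      (tendsto_pow_atTop_nhds_zero_of_lt_one (by norm_num) (by norm_num)).const_mul _
    rw [mul_zero] at hlim
    exact ge_of_tendsto hlim (eventually_atTop.2
      ⟨N, fun n hn => (dual_mono hf (hsσ n)).trans (hσC n hn)⟩)

/-- If the norm is order continuous then, on order intervals, it is dominated by a functional
from any norming cone, up to `ε`. -/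
theorem OrderContinuousNorm.exists_norm_le_apply_add [CompleteSpace E] (h : OrderContinuousNorm E)
    {P : Set (StrongDual ℝ E)} (hpos : ∀ p ∈ P, 0 ≤ p) (h0 : 0 ∈ P)
    (hadd : ∀ p ∈ P, ∀ q ∈ P, p + q ∈ P) (hsmul : ∀ c : ℝ, 0 ≤ c → ∀ p ∈ P, c • p ∈ P)
    (hnorm : ∀ y : E, 0 ≤ y → ∀ c < ‖y‖, ∃ p ∈ P, ‖p‖ ≤ 1 ∧ c < p y)
    (x : E) {ε : ℝ} (hε : 0 < ε) :
    ∃ p ∈ P, ∀ y ∈ Set.Icc 0 x, ‖y‖ ≤ p y + ε := by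
  by_contra! hc
  have hstep : ∀ w : P, ∃ q : P × E, ‖q.1.1‖ ≤ 1 ∧ q.2 ∈ Set.Icc 0 x ∧
      w.1 q.2 + ε < q.1.1 q.2 := by
    rintro ⟨w, hw⟩
    obtain ⟨y, hy, hwy⟩ := hc w hw
    obtain ⟨p, hp, hp1, hpy⟩ := hnorm y hy.1 _ hwy
    exact ⟨⟨⟨p, hp⟩, y⟩, hp1, hy, hpy⟩
  choose q hq1 hqx hq using hstep
  let scale : ℕ → P → P := fun n w => ⟨(2 : ℝ) ^ n • w.1, hsmul _ (by positivity) _ w.2⟩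
  -- `W n` is the sum of the earlier `p k`. Failure of the claim at `2 ^ n • W n` yields `p n` and
  -- `y n`, so that each fixed `p k` is at most `‖x‖ / 2 ^ n` at `y n` for `n > k` and thus vanishes
  -- at the limit superior `s`.
  let W : ℕ → P := fun n => Nat.rec ⟨0, h0⟩
    (fun n w => ⟨w.1 + (q (scale n w)).1.1, hadd _ w.2 _ (q (scale n w)).1.2⟩) n
  let p : ℕ → StrongDual ℝ E := fun n => (q (scale n (W n))).1.1
  let y : ℕ → E := fun n => (q (scale n (W n))).2
  have hp0 : ∀ n, 0 ≤ p n := fun n => hpos _ (q (scale n (W n))).1.2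
  have hW : ∀ n, (W (n + 1)).1 = (W n).1 + p n := fun n => rfl
  have hWmono : Monotone fun n => (W n).1 := monotone_nat_of_le_succ fun n => by
    rw [hW]; exact le_add_of_nonneg_right (hp0 n)
  have hpW : ∀ k n, k + 1 ≤ n → p k ≤ (W n).1 := fun k n hkn =>
    (by rw [hW]; exact le_add_of_nonneg_left (hpos _ (W k).2) : p k ≤ (W (k + 1)).1).trans
      (hWmono hkn)
  have hyx : ∀ n, y n ∈ Set.Icc 0 x := fun n => hqx _
  have hpn : ∀ n, ‖p n‖ ≤ 1 := fun n => hq1 _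
  have hlt : ∀ n, 2 ^ n * (W n).1 (y n) + ε < p n (y n) := fun n => hq (scale n (W n))
  obtain ⟨σ, s, hyσ, hs, hsσ, hlim, hzero⟩ := h.exists_limsup hyx
  have hps : ∀ k, p k s = 0 := fun k => by
    refine hzero (p k) (hp0 k) ‖x‖ (k + 1) fun n hn => ?_
    have h1 := hpW k n hn (y n) (hyx n).1
    have h2 : p n (y n) ≤ ‖x‖ :=
      (dual_apply_le_norm (hpn n) _).trans (norm_le_norm_of_le (hyx n).1 (hyx n).2)
    have h3 : 2 ^ n * (W n).1 (y n) ≤ ‖x‖ := by linarith [hlt n]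
    rw [one_div, inv_pow, ← div_eq_mul_inv, le_div_iff₀ (by positivity), mul_comm]
    exact (mul_le_mul_of_nonneg_left h1 (by positivity)).trans h3
  -- Since `p n s = 0`, `ε < p n (y n) ≤ p n (σ n - s)`; this contradicts `σ n → s`.
  have hσs : ∀ n, ε ≤ ‖σ n - s‖ := fun n => by
    have h1 := dual_mono (hp0 n) (hyσ n)
    have h2 := dual_apply_le_norm (hpn n) (σ n - s)
    rw [map_sub, hps] at h2
    have h3 := dual_nonneg (hpos _ (W n).2) (hyx n).1
    have h4 : 0 ≤ 2 ^ n * (W n).1 (y n) := by positivity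
    linarith [hlt n]
  have := ge_of_tendsto' (tendsto_iff_norm_sub_tendsto_zero.1 hlim) hσs
  linarith

/-- Absolute continuity in the manner of Radon-Nikodym. Were it false, there would be `z n` with `b
(z n)` of order `2 ^ (-n)` but `f (z n) > ε`; strict positivity of `b` kills their limit superior,
while `f` stays at least `ε` there. -/
theorem OrderContinuousNorm.exists_posPart_sub_smul_le [CompleteSpace E]
    (h : OrderContinuousNorm E) {b f : StrongDual ℝ E} (hb : 0 ≤ b) (hf : 0 ≤ f) {y : E}
    (hy : 0 ≤ y) (hby : ∀ z ∈ Set.Icc 0 y, b z = 0 → z = 0) {ε : ℝ} (hε : 0 < ε) :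
    ∃ c : ℝ, 0 ≤ c ∧ (f - c • b)⁺ y ≤ ε := by
  by_contra! hc
  choose z hz hzlt using fun n : ℕ => exists_lt_apply_of_lt_dual_posPart _ hy
    (hc ((2 : ℝ) ^ n) (by positivity))
  have hzlt' : ∀ n, ε < f (z n) - 2 ^ n * b (z n) := fun n => by simpa using hzlt n
  obtain ⟨σ, s, hzσ, hs, -, hlim, hzero⟩ := h.exists_limsup hz
  have hs0 : s = 0 := by
    refine hby s hs (hzero b hb (f y) 0 fun n _ => ?_)
    rw [one_div, inv_pow, ← div_eq_mul_inv, le_div_iff₀ (by positivity), mul_comm]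
    linarith [hzlt' n, dual_mono hf (hz n).2]
  have hlim' : Tendsto (fun n => f (σ n)) atTop (𝓝 (f s)) := (f.continuous.tendsto s).comp hlim
  have h1 : ε ≤ f s := ge_of_tendsto' hlim' fun n => by
    have h2 := dual_nonneg hb (hz n).1
    have h3 : 0 ≤ 2 ^ n * b (z n) := by positivity
    linarith [hzlt' n, dual_mono hf (hzσ n)]
  rw [hs0, map_zero] at h1
  linarith

/-- Along a decreasing net the reals `p (x a)` converge, so the domination makes the net Cauchy in
norm, and its limit has to be the infimum `0`. -/
theorem orderContinuousNorm_of_norm_le_apply_add [CompleteSpace E]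
    (h : ∀ x : E, 0 ≤ x → ∀ ε : ℝ, 0 < ε →
      ∃ p : StrongDual ℝ E, 0 ≤ p ∧ ∀ y ∈ Set.Icc 0 x, ‖y‖ ≤ p y + ε) :
    OrderContinuousNorm E := by
  intro ι _ _ _ x hx
  have hx0 : ∀ a, 0 ≤ x a := fun a => hx.2.1 ⟨a, rfl⟩
  have hcau : Cauchy (map x atTop) := by
    rw [Metric.cauchy_iff]
    refine ⟨inferInstance, fun ε hε => ?_⟩
    obtain ⟨a₀⟩ := ‹Nonempty ι›
    obtain ⟨p, hp, hpx⟩ := h (x a₀) (hx0 a₀) (ε / 6) (by positivity)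
    have hanti : Antitone fun a => p (x a) := fun a b hab => dual_mono hp (hx.1 hab)
    have hbdd : BddBelow (Set.range fun a => p (x a)) :=
      ⟨0, by rintro _ ⟨a, rfl⟩; exact dual_nonneg hp (hx0 a)⟩
    obtain ⟨a₁, ha₁⟩ := exists_lt_of_ciInf_lt
      (lt_add_of_pos_right (⨅ a, p (x a)) (by positivity : 0 < ε / 6))
    obtain ⟨a₂, h02, h12⟩ := exists_ge_ge a₀ a₁
    have hsmall : ∀ a ≥ a₂, ‖x a₂ - x a‖ ≤ ε / 3 := fun a ha => by
      have h1 := hpx (x a₂ - x a) ⟨sub_nonneg.2 (hx.1 ha),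
        (sub_le_self _ (hx0 a)).trans (hx.1 h02)⟩
      have h2 : ⨅ a, p (x a) ≤ p (x a) := ciInf_le hbdd a
      have h3 := hanti h12
      rw [map_sub] at h1
      simp only at h3
      linarith
    refine ⟨x '' Set.Ici a₂, image_mem_map (Ici_mem_atTop a₂), ?_⟩
    rintro _ ⟨a, ha, rfl⟩ _ ⟨b, hb, rfl⟩
    have h1 := hsmall a ha
    have h2 := hsmall b hb
    rw [← dist_eq_norm] at h1 h2
    have h3 := dist_triangle_left (x a) (x b) (x a₂)
    linarith
  obtain ⟨l, hl⟩ := CompleteSpace.complete hcau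
  have hl' : Tendsto x atTop (𝓝 l) := hl
  have h1 : l ≤ 0 := hx.2.2 (by
    rintro _ ⟨a, rfl⟩
    exact hx.1.le_of_tendsto hl' a)
  have h2 : 0 ≤ l := ge_of_tendsto' hl' hx0
  rw [le_antisymm h1 h2] at hl'
  simpa using hl'.norm

/-- Dini's theorem by Hahn-Banach: the vectors above some `x a` form a convex set, so having `0` in
its weak closure puts `0` in its norm closure, and monotonicity does the rest. -/
theorem tendsto_norm_of_antitone_of_weaklyNull {ι : Type v} [Preorder ι] [IsDirectedOrder ι]
    [Nonempty ι] {x : ι → E} [IsOrderedModule ℝ E] (hx : Antitone x) (hx0 : ∀ a, 0 ≤ x a)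
    (hw : WeaklyNull x) : Tendsto (fun a => ‖x a‖) atTop (𝓝 0) := by
  let S : Set E := {z | ∃ a, x a ≤ z}
  have hconv : Convex ℝ S := by
    rintro y ⟨a, hay⟩ z ⟨b, hbz⟩ s t hs ht hst
    obtain ⟨c, hac, hbc⟩ := exists_ge_ge a b
    refine ⟨c, ?_⟩
    calc x c = s • x c + t • x c := by rw [← add_smul, hst, one_smul]
      _ ≤ s • y + t • z := add_le_add (smul_le_smul_of_nonneg_left ((hx hac).trans hay) hs)
          (smul_le_smul_of_nonneg_left ((hx hbc).trans hbz) ht)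
  have h0 : (0 : E) ∈ closure S := by
    by_contra hn
    obtain ⟨f, r, hr, hfr⟩ := geometric_hahn_banach_point_closed hconv.closure isClosed_closure hn
    rw [map_zero] at hr
    have h1 : r ≤ 0 := ge_of_tendsto' (hw f) fun a => (hfr _ (subset_closure ⟨a, le_rfl⟩)).le
    linarith
  rw [Metric.tendsto_nhds]
  intro ε hε
  obtain ⟨z, ⟨a, haz⟩, hz⟩ := Metric.mem_closure_iff.1 h0 ε hε
  filter_upwards [Ici_mem_atTop a] with b hb
  rw [dist_zero_left] at hz
  rw [dist_zero_right, norm_norm]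
  exact (norm_le_norm_of_le (hx0 b) ((hx hb).trans haz)).trans_lt hz

end OrderContinuous

/-! ### A Banach lattice with order continuous norm is an ideal of its bidual -/

section Bidual

open NormedSpace (inclusionInDoubleDual)

variable {E : Type u} [NormedAddCommGroup E] [NormedSpace ℝ E] [Lattice E]
  [IsOrderedAddMonoid E] [HasSolidNorm E]

/-- On the positive cone the values decrease and are bounded below; the pointwise limit is
continuous because it is dominated by one `φ a₀`. -/
theorem exists_tendsto_of_antitone {ι : Type v} [Preorder ι] [IsDirectedOrder ι] [Nonempty ι]
    {φ : ι → StrongDual ℝ E} (hφ : Antitone φ) (h0 : ∀ a, 0 ≤ φ a) :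
    ∃ ψ : StrongDual ℝ E, 0 ≤ ψ ∧ (∀ a, ψ ≤ φ a) ∧
      ∀ x, Tendsto (fun a => φ a x) atTop (𝓝 (ψ x)) := by
  have hpos : ∀ x : E, 0 ≤ x → ∃ l, Tendsto (fun a => φ a x) atTop (𝓝 l) := fun x hx =>
    ⟨_, tendsto_atTop_ciInf (fun a b hab => hφ hab x hx)
      ⟨0, by rintro _ ⟨a, rfl⟩; exact dual_nonneg (h0 a) hx⟩⟩
  have hall : ∀ x : E, ∃ l, Tendsto (fun a => φ a x) atTop (𝓝 l) := fun x => by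
    obtain ⟨l, hl⟩ := hpos _ (posPart_nonneg x)
    obtain ⟨l', hl'⟩ := hpos _ (negPart_nonneg x)
    refine ⟨l - l', (hl.sub hl').congr fun a => ?_⟩
    rw [← map_sub, posPart_sub_negPart]
  choose l hl using hall
  let L : E →ₗ[ℝ] ℝ := linearMapOfTendsto l (fun a => (φ a).toLinearMap) (tendsto_pi_nhds.2 hl)
  obtain ⟨a₀⟩ := ‹Nonempty ι›
  let ψ : StrongDual ℝ E := L.mkContinuous ‖φ a₀‖ fun x => by
    refine le_of_tendsto (hl x).norm ?_
    filter_upwards [Ici_mem_atTop a₀] with a ha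
    have h1 := dual_abs_apply_le (φ a) x
    rw [abs_of_nonneg (h0 a)] at h1
    calc ‖φ a x‖ ≤ φ a |x| := h1
      _ ≤ φ a₀ |x| := hφ ha _ (abs_nonneg x)
      _ ≤ ‖φ a₀‖ * ‖|x|‖ := (Real.le_norm_self _).trans ((φ a₀).le_opNorm _)
      _ = ‖φ a₀‖ * ‖x‖ := by rw [norm_abs_eq_norm]
  refine ⟨ψ, fun x hx => ge_of_tendsto' (hl x) fun a => h0 a x hx, fun a x hx => ?_, hl⟩
  exact Antitone.le_of_tendsto (fun a b hab => hφ hab x hx) (hl x) a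

theorem inclusionInDoubleDual_mono {x y : E} (h : x ≤ y) :
    inclusionInDoubleDual ℝ E x ≤ inclusionInDoubleDual ℝ E y :=
  fun _ hf => dual_mono hf h

theorem inclusionInDoubleDual_nonneg {x : E} (h : 0 ≤ x) : 0 ≤ inclusionInDoubleDual ℝ E x :=
  fun _ hf => dual_nonneg hf h

theorem inclusionInDoubleDual_le_iff [IsOrderedModule ℝ E] {x y : E} :
    inclusionInDoubleDual ℝ E x ≤ inclusionInDoubleDual ℝ E y ↔ x ≤ y :=
  ⟨fun h => le_of_forall_dual_le fun f hf => h f hf, inclusionInDoubleDual_mono⟩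

/-- A Hahn decomposition: a part of `f` that is null for `m⁺` but not for `m⁻`. -/
theorem exists_posPart_apply_eq_zero {m : StrongDual ℝ (StrongDual ℝ E)} {x : E}
    (hm : m⁻ ≤ inclusionInDoubleDual ℝ E x) {f : StrongDual ℝ E} (hf : 0 ≤ f) (hmf : m f < 0) :
    ∃ b : StrongDual ℝ E, 0 ≤ b ∧ m⁺ b = 0 ∧ 0 < m⁻ b := by
  have hsplit : ∀ g, m g = m⁺ g - m⁻ g := fun g => by
    conv_lhs => rw [← posPart_sub_negPart m]
    rfl
  have hp := posPart_nonneg m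
  have hn := negPart_nonneg m
  set δ := m⁻ f with hδ
  have hδ0 : 0 < δ := by linarith [hsplit f, dual_nonneg hp hf]
  -- `m⁺ f - m (c n) = m⁺ (f - c n) + m⁻ (c n)` with both terms nonnegative, so a near-maximiser `c
  -- n` of `m` on `[0, f]` makes both small.
  choose c hc hlt using fun n : ℕ => exists_lt_apply_of_lt_dual_posPart m hf
    (show m⁺ f - δ / 4 * (1 / 2) ^ n < m⁺ f by
      have : 0 < δ / 4 * (1 / 2) ^ n := by positivity
      linarith)
  have hpc : ∀ n, m⁺ (f - c n) ≤ δ / 4 * (1 / 2) ^ n := fun n => by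
    rw [map_sub]
    linarith [hlt n, hsplit (c n), dual_nonneg hn (hc n).1]
  have hnc : ∀ n, m⁻ (c n) ≤ δ / 4 * (1 / 2) ^ n := fun n => by
    linarith [hlt n, hsplit (c n), dual_mono hp (hc n).2]
  let d : ℕ → StrongDual ℝ E := fun n => partialSups c n
  have hdf : ∀ n, d n ≤ f := fun n => partialSups_le _ _ _ fun k _ => (hc k).2
  have hd0 : ∀ n, 0 ≤ d n := fun n => (hc n).1.trans (le_partialSups c n)
  have hnd : ∀ n, m⁻ (d n) ≤ δ / 2 - δ / 4 * (1 / 2) ^ n := fun n => by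
    induction n with
    | zero =>
      have := hnc 0
      simp only [d, partialSups_zero, pow_zero] at this ⊢
      linarith
    | succ n ih =>
      have h1 : d (n + 1) ≤ d n + c (n + 1) := by
        simp only [d, partialSups_add_one]
        exact sup_le (le_add_of_nonneg_right (hc _).1) (le_add_of_nonneg_left (hd0 n))
      have h2 := dual_mono hn h1
      rw [map_add] at h2
      have h3 := hnc (n + 1)
      rw [pow_succ] at h3 ⊢
      linarith
  obtain ⟨b, hb0, hbd, hblim⟩ := exists_tendsto_of_antitone (φ := fun n => f - d n)
    (fun i j hij => sub_le_sub_left (partialSups_monotone c hij) f)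
    (fun n => sub_nonneg.2 (hdf n))
  refine ⟨b, hb0, le_antisymm ?_ (dual_nonneg hp hb0), ?_⟩
  · have hlim : Tendsto (fun n : ℕ => δ / 4 * (1 / 2 : ℝ) ^ n) atTop (𝓝 (δ / 4 * 0)) :=
      (tendsto_pow_atTop_nhds_zero_of_lt_one (by norm_num) (by norm_num)).const_mul _
    rw [mul_zero] at hlim
    exact ge_of_tendsto' hlim fun n => (dual_mono hp ((hbd n).trans
      (sub_le_sub_left (le_partialSups c n) f))).trans (hpc n)
  -- The bound `m⁻ ≤ x` supplies the order continuity of `m⁻` needed to pass from `m⁻ (f - d n) ≥ δ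
  -- / 2` to the limit `b`.
  · have h1 : ∀ n, δ / 2 - ((f - d n) x - b x) ≤ m⁻ b := fun n => by
      have h2 := hm (f - d n - b) (sub_nonneg.2 (hbd n))
      rw [map_sub, map_sub, ← hδ] at h2
      have h3 : inclusionInDoubleDual ℝ E x (f - d n - b) = (f - d n) x - b x := rfl
      rw [h3] at h2
      have h4 : 0 ≤ δ / 4 * (1 / 2) ^ n := by positivity
      linarith [hnd n]
    have h5 := le_of_tendsto' (((hblim x).sub_const (b x)).const_sub (δ / 2)) h1
    rw [sub_self, sub_zero] at h5
    linarith

variable [CompleteSpace E] [IsOrderedModule ℝ E]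

/-- A Hahn decomposition of `ε • x - h` gives `b ≥ 0` on which `h` dominates `ε • x`. Deleting from
`x` the largest part `t` null for `b` leaves `x - t`, where every positive functional is nearly
dominated by a multiple of `b`; hence `ε • (x - t) ≤ h`. -/
theorem OrderContinuousNorm.exists_inclusionInDoubleDual_le (hE : OrderContinuousNorm E) {x : E}
    (hx : 0 ≤ x) {h : StrongDual ℝ (StrongDual ℝ E)} (h0 : 0 ≤ h)
    (hhx : h ≤ inclusionInDoubleDual ℝ E x) (hne : h ≠ 0) :
    ∃ y : E, 0 ≤ y ∧ y ≠ 0 ∧ inclusionInDoubleDual ℝ E y ≤ h := by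
  obtain ⟨f, hf, hhf⟩ : ∃ f : StrongDual ℝ E, 0 ≤ f ∧ 0 < h f := by
    by_contra! hc
    exact hne (le_antisymm (fun f hf => hc f hf) h0)
  have hfx := dual_nonneg hf hx
  obtain ⟨ε, hε, hεf⟩ : ∃ ε : ℝ, 0 < ε ∧ ε * f x < h f := by
    refine ⟨h f / (f x + 1), by positivity, ?_⟩
    rw [div_mul_eq_mul_div, div_lt_iff₀ (by positivity)]
    linarith
  set m : StrongDual ℝ (StrongDual ℝ E) := ε • inclusionInDoubleDual ℝ E x - h with hm
  have hmapp : ∀ g, m g = ε * g x - h g := fun g => rfl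
  have hmh : m⁻ ≤ h := by
    have hneg : -m = h - ε • inclusionInDoubleDual ℝ E x := by
      ext k
      change -(ε * k x - h k) = h k - ε * k x
      ring
    exact sup_le (hneg.le.trans (sub_le_self _ (smul_nonneg hε.le (inclusionInDoubleDual_nonneg hx)))) h0
  obtain ⟨b, hb, hb1, hb2⟩ := exists_posPart_apply_eq_zero (hmh.trans hhx) hf
    (by rw [hmapp]; linarith)
  have hbx : 0 < b x := hb2.trans_le ((hmh.trans hhx) b hb)
  -- the part of `x` on which `b` is strictly positive
  let S : Set E := {z | z ∈ Set.Icc 0 x ∧ b z = 0}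
  obtain ⟨t, ht, htc⟩ := hE.exists_isLUB (S := S) ⟨0, ⟨le_rfl, hx⟩, map_zero b⟩
    (by
      rintro z ⟨hz, hbz⟩ w ⟨hw, hbw⟩
      refine ⟨z ⊔ w, ⟨⟨hz.1.trans le_sup_left, sup_le hz.2 hw.2⟩, le_antisymm ?_ ?_⟩,
        le_sup_left, le_sup_right⟩
      · have h1 : z ⊔ w ≤ z + w :=
          sup_le (le_add_of_nonneg_right hw.1) (le_add_of_nonneg_left hz.1)
        have h2 := dual_mono hb h1
        rwa [map_add, hbz, hbw, add_zero] at h2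
      · exact dual_nonneg hb (hz.1.trans le_sup_left))
    ⟨x, fun z hz => hz.1.2⟩
  have hbt : b t = 0 :=
    closure_minimal (s := S) (t := {z | b z = 0}) (fun z hz => hz.2)
      (isClosed_eq b.continuous continuous_const) htc
  have ht0 : 0 ≤ t := ht.1 ⟨⟨le_rfl, hx⟩, map_zero b⟩
  have htx : t ≤ x := ht.2 fun z hz => hz.1.2
  have hy0 : 0 ≤ x - t := sub_nonneg.2 htx
  have hstrict : ∀ z ∈ Set.Icc 0 (x - t), b z = 0 → z = 0 := fun z hz hbz => by
    have h1 : t + z ∈ S := ⟨⟨add_nonneg ht0 hz.1, le_sub_iff_add_le'.1 hz.2⟩, by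
      rw [map_add, hbt, hbz, add_zero]⟩
    exact le_antisymm (by simpa using ht.1 h1) hz.1
  refine ⟨ε • (x - t), smul_nonneg hε.le hy0, ?_, ?_⟩
  · intro hzero
    have h1 := congrArg b hzero
    rw [map_smul, map_sub, hbt, sub_zero, map_zero, smul_eq_mul] at h1
    exact (mul_pos hε hbx).ne' h1
  · intro g hg
    change g (ε • (x - t)) ≤ h g
    rw [map_smul, smul_eq_mul]
    refine le_of_forall_pos_le_add fun η hη => ?_
    obtain ⟨c, hc, hcg⟩ := hE.exists_posPart_sub_smul_le hb hg hy0 hstrict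
      (show 0 < η / ε by positivity)
    -- `g - k ≤ c • b` lies where `m` is nonpositive, while the rest `k` contributes at most `η / ε`
    -- at `x - t`.
    set k := (g - c • b)⁺ with hk
    have hkg : k ≤ g := sup_le (sub_le_self _ (smul_nonneg hc hb)) hg
    have hgk : g - k ≤ c • b := sub_le_comm.1 (le_posPart _)
    have hgk0 : 0 ≤ g - k := sub_nonneg.2 hkg
    have h1 : m (g - k) ≤ 0 := by
      have h2 := dual_mono (posPart_nonneg m) hgk
      rw [map_smul, hb1, smul_zero] at h2
      exact (le_posPart m _ hgk0).trans h2
    rw [hmapp] at h1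
    have h3 : h (g - k) ≤ h g := dual_mono h0 (sub_le_self _ (posPart_nonneg _))
    have h4 : (g - k) (x - t) ≤ (g - k) x := dual_mono hgk0 (sub_le_self _ ht0)
    have h5 : (g - k) (x - t) = g (x - t) - k (x - t) := rfl
    have h6 : ε * k (x - t) ≤ η := by
      rw [le_div_iff₀ hε] at hcg; linarith
    have h7 := mul_le_mul_of_nonneg_left h4 hε.le
    rw [h5, mul_sub] at h7
    linarith

/-- If the norm of `E` is order continuous then `E` is an ideal of `E''`. -/
theorem OrderContinuousNorm.exists_inclusionInDoubleDual_eq (hE : OrderContinuousNorm E) {x : E}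
    {g : StrongDual ℝ (StrongDual ℝ E)} (h0 : 0 ≤ g)
    (hgx : g ≤ inclusionInDoubleDual ℝ E x) : ∃ y : E, inclusionInDoubleDual ℝ E y = g := by
  have hle : ∀ {y}, inclusionInDoubleDual ℝ E y ≤ g → y ≤ x := fun h =>
    inclusionInDoubleDual_le_iff.1 (h.trans hgx)
  let A : Set E := {y | inclusionInDoubleDual ℝ E y ≤ g}
  have h0A : (0 : E) ∈ A := by
    change inclusionInDoubleDual ℝ E 0 ≤ g
    rwa [map_zero]
  obtain ⟨s, hs, hsc⟩ := hE.exists_isLUB (S := A) ⟨0, h0A⟩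
    (by
      intro y hy z hz
      refine ⟨y ⊔ z, fun f hf => ?_, le_sup_left, le_sup_right⟩
      -- `f (y ⊔ z) = (f - k) z + k y` for an attaining `k`, so the two bounds by `g` add up to `g
      -- f`.
      obtain ⟨k, hk, hkf, hkv⟩ := exists_dual_apply_eq_posPart hf (y - z)
      have h1 : y ⊔ z = z + (y - z)⁺ := sup_eq_add_posPart_sub y z
      change f (y ⊔ z) ≤ g f
      rw [h1, map_add, ← hkv, map_sub]
      have h2 : (f - k) z ≤ g (f - k) := hz _ (sub_nonneg.2 hkf)
      have h3 : k y ≤ g k := hy _ hk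
      rw [map_sub, sub_apply] at h2
      linarith)
    ⟨x, fun y hy => hle hy⟩
  have hsA : s ∈ A := fun f hf =>
    closure_minimal (s := A) (t := {z | f z ≤ g f}) (fun z hz => hz f hf)
      (isClosed_le f.continuous continuous_const) hsc
  refine ⟨s, ?_⟩
  by_contra hne
  have hs0 : 0 ≤ s := hs.1 h0A
  have hsub : 0 ≤ g - inclusionInDoubleDual ℝ E s := fun f hf => sub_nonneg.2 (hsA f hf)
  have hsubx : g - inclusionInDoubleDual ℝ E s ≤ inclusionInDoubleDual ℝ E x :=
    (sub_le_self g (inclusionInDoubleDual_nonneg hs0)).trans hgx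
  -- A nonzero remainder `g - s` would dominate some nonzero `y ≥ 0` of `E`, and `s + y ∈ A` would
  -- exceed the supremum.
  obtain ⟨y, hy0, hyne, hy⟩ := hE.exists_inclusionInDoubleDual_le (hle h0A) hsub hsubx
    (sub_ne_zero.2 (Ne.symm hne))
  have h1 : s + y ∈ A := by
    change inclusionInDoubleDual ℝ E (s + y) ≤ g
    rw [map_add]
    exact le_sub_iff_add_le'.1 hy
  exact hyne (le_antisymm (by simpa using hs.1 h1) hy0)

end Bidual

/-! ### The unbounded absolute weak* dual -/

section UawStar

open NormedSpace (inclusionInDoubleDual inclusionInDoubleDualLi)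

variable {E : Type u} [NormedAddCommGroup E] [NormedSpace ℝ E] [Lattice E]
  [IsOrderedAddMonoid E] [HasSolidNorm E]

instance isDirectedOrder_nonneg : IsDirectedOrder {x : E // 0 ≤ x} :=
  ⟨fun a b => ⟨⟨a.1 ⊔ b.1, a.2.trans le_sup_left⟩,
    (le_sup_left : a.1 ≤ a.1 ⊔ b.1), (le_sup_right : b.1 ≤ a.1 ⊔ b.1)⟩⟩

instance nonempty_nonneg : Nonempty {x : E // 0 ≤ x} := ⟨⟨0, le_rfl⟩⟩

/-- Nullity test for the nets indexed by the positive cone: past the index `n • w` the value is at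
most `c / n`. -/
theorem tendsto_zero_of_forall_natCast_smul_le [IsOrderedModule ℝ E] {w : E} (hw : 0 ≤ w)
    {c : ℝ} {r : {x : E // 0 ≤ x} → ℝ} (hr0 : ∀ a, 0 ≤ r a)
    (hr : ∀ (n : ℝ) (a : {x : E // 0 ≤ x}), 1 ≤ n → n • w ≤ a.1 → n * r a ≤ c) :
    Tendsto r atTop (𝓝 0) := by
  rw [Metric.tendsto_nhds]
  intro ε hε
  obtain ⟨n, hn⟩ := exists_nat_gt (max 1 (c / ε))
  have hn1 : (1 : ℝ) ≤ n := (le_max_left _ _).trans hn.le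
  have hn2 : c < n * ε := (div_lt_iff₀ hε).1 ((le_max_right _ _).trans_lt hn)
  filter_upwards [Ici_mem_atTop (⟨(n : ℝ) • w, smul_nonneg (by positivity) hw⟩ : {x : E // 0 ≤ x})]
    with a ha
  rw [Real.dist_eq, sub_zero, abs_of_nonneg (hr0 a)]
  exact lt_of_mul_lt_mul_left ((hr n a hn1 ha).trans_lt hn2) (by positivity)

/-- Otherwise there are `g x` in the unit ball with `|g x| x ≤ 1` and `|F (g x)| > ε`. For indices
above `n • |e|` one has `|g x| |e| ≤ 1 / n`, so this net is uaw*-null, a contradiction. -/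
theorem exists_abs_apply_le_of_mem_uawStarDual [IsOrderedModule ℝ E]
    {F : StrongDual ℝ E →ₗ[ℝ] ℝ} (hF : F ∈ uawStarDual E) {ε : ℝ} (hε : 0 < ε) :
    ∃ x : E, 0 ≤ x ∧ ∀ g : StrongDual ℝ E, ‖g‖ ≤ 1 → |g| x ≤ 1 → |F g| ≤ ε := by
  by_contra! hc
  choose g hg1 hgx hgF using fun x : {x : E // 0 ≤ x} => hc x.1 x.2
  have hnull : UawStarNull g := by
    intro w hw e
    have h0 : ∀ a, 0 ≤ |g a| ⊓ w := fun a => le_inf (abs_nonneg _) hw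
    refine squeeze_zero_norm (fun a => ?_) (tendsto_zero_of_forall_natCast_smul_le
      (abs_nonneg e) (c := 1) (r := fun a => |g a| |e|)
      (fun a => dual_nonneg (abs_nonneg _) (abs_nonneg e)) fun n a _ ha => ?_)
    · have h1 := dual_abs_apply_le (|g a| ⊓ w) e
      rw [abs_of_nonneg (h0 a)] at h1
      exact h1.trans ((inf_le_left : |g a| ⊓ w ≤ |g a|) _ (abs_nonneg e))
    · have h1 := dual_mono (abs_nonneg (g a)) ha
      rw [map_smul, smul_eq_mul] at h1
      exact h1.trans (hgx a)
  have hlim := hF.2 _ g ⟨1, hg1⟩ hnull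
  have h1 := ge_of_tendsto' hlim.abs fun a => (hgF a).le
  rw [abs_zero] at h1
  linarith

/-- The embedding is isometric and `E` is complete, so its range is closed. -/
theorem mem_range_inclusionInDoubleDual_of_norm_sub_le [CompleteSpace E]
    {G : StrongDual ℝ (StrongDual ℝ E)}
    (h : ∀ ε : ℝ, 0 < ε → ∃ y : E, ‖G - inclusionInDoubleDual ℝ E y‖ ≤ ε) :
    G ∈ Set.range (inclusionInDoubleDual ℝ E) := by
  choose y hy using fun n : ℕ => h ((1 / 2) ^ n) (by positivity)
  have hJ : ∀ z : E, ‖inclusionInDoubleDual ℝ E z‖ = ‖z‖ :=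
    (inclusionInDoubleDualLi (E := E) ℝ).norm_map
  have hcau : CauchySeq y := by
    refine cauchySeq_of_le_geometric (1 / 2) 2 (by norm_num) fun n => ?_
    rw [dist_eq_norm, ← hJ, map_sub]
    have h1 : inclusionInDoubleDual ℝ E (y n) - inclusionInDoubleDual ℝ E (y (n + 1)) =
        (G - inclusionInDoubleDual ℝ E (y (n + 1))) - (G - inclusionInDoubleDual ℝ E (y n)) := by
      abel
    rw [h1]
    have h2 := hy (n + 1)
    rw [pow_succ] at h2
    have h3 : (0 : ℝ) ≤ (1 / 2) ^ n := by positivity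
    linarith [hy n, norm_sub_le (G - inclusionInDoubleDual ℝ E (y (n + 1)))
      (G - inclusionInDoubleDual ℝ E (y n))]
  obtain ⟨s, hs⟩ := cauchySeq_tendsto_of_complete hcau
  refine ⟨s, ContinuousLinearMap.ext fun f => ?_⟩
  have h1 : Tendsto (fun n => G f - f (y n)) atTop (𝓝 0) := by
    have hlim : Tendsto (fun n : ℕ => (1 / 2 : ℝ) ^ n * ‖f‖) atTop (𝓝 (0 * ‖f‖)) :=
      (tendsto_pow_atTop_nhds_zero_of_lt_one (by norm_num) (by norm_num)).mul_const _
    rw [zero_mul] at hlim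
    refine squeeze_zero_norm (fun n => ?_) hlim
    exact ((G - inclusionInDoubleDual ℝ E (y n)).le_opNorm f).trans
      (mul_le_mul_of_nonneg_right (hy n) (norm_nonneg f))
  have h2 := tendsto_nhds_unique h1 (((f.continuous.tendsto s).comp hs).const_sub (G f))
  change f s = G f
  linarith

theorem OrderContinuousNorm.mem_range_inclusionInDoubleDual [CompleteSpace E]
    [IsOrderedModule ℝ E] (hE : OrderContinuousNorm E) {G : StrongDual ℝ (StrongDual ℝ E)}
    (hG : 0 ≤ G)
    (h : ∀ ε : ℝ, 0 < ε → ∃ x : E, 0 ≤ x ∧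
      ∀ g : StrongDual ℝ E, 0 ≤ g → ‖g‖ ≤ 1 → g x ≤ 1 → G g ≤ ε) :
    G ∈ Set.range (inclusionInDoubleDual ℝ E) := by
  refine mem_range_inclusionInDoubleDual_of_norm_sub_le fun ε hε => ?_
  obtain ⟨x, hx, hxG⟩ := h (ε / 2) (by positivity)
  set m := G - inclusionInDoubleDual ℝ E (‖G‖ • x) with hm
  have hmapp : ∀ k, m k = G k - ‖G‖ * k x := fun k => by
    change G k - k (‖G‖ • x) = _
    rw [map_smul, smul_eq_mul]
  have hGx : 0 ≤ inclusionInDoubleDual ℝ E (‖G‖ • x) :=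
    inclusionInDoubleDual_nonneg (smul_nonneg (norm_nonneg G) hx)
  have hmG : m⁺ ≤ G := sup_le (sub_le_self _ hGx) hG
  have hk : ∀ k : StrongDual ℝ E, 0 ≤ k → ‖k‖ ≤ 1 → m k ≤ ε / 2 := by
    intro k hk hk1
    rw [hmapp]
    -- If `k x ≤ ‖k‖`, the hypothesis applies to `k` normalised; otherwise `‖G‖ * k x` already
    -- exceeds `G k`. The factor `‖G‖` in `m` serves this second case.
    by_cases hkx : k x ≤ ‖k‖
    · rcases (norm_nonneg k).eq_or_lt with h0 | h0
      · have : k = 0 := norm_eq_zero.1 h0.symm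
        rw [this, map_zero, zero_apply, mul_zero, sub_zero]
        positivity
      · have h1 := hxG (‖k‖⁻¹ • k) (smul_nonneg (by positivity) hk)
          (by rw [norm_smul, norm_inv, norm_norm, inv_mul_cancel₀ h0.ne'])
          (by
            change ‖k‖⁻¹ * k x ≤ 1
            rwa [inv_mul_le_iff₀ h0, mul_one])
        rw [map_smul, smul_eq_mul, inv_mul_le_iff₀ h0] at h1
        have h2 : ‖k‖ * (ε / 2) ≤ ε / 2 := mul_le_of_le_one_left (by positivity) hk1
        have h3 : 0 ≤ ‖G‖ * k x := mul_nonneg (norm_nonneg G) (dual_nonneg hk hx)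
        linarith
    · have h1 : G k ≤ ‖G‖ * ‖k‖ := (Real.le_norm_self _).trans (G.le_opNorm k)
      have h2 : ‖G‖ * ‖k‖ ≤ ‖G‖ * k x :=
        mul_le_mul_of_nonneg_left (not_le.1 hkx).le (norm_nonneg G)
      linarith
  have hnorm : ‖m⁺‖ ≤ ε / 2 := dual_norm_le_of_nonneg (posPart_nonneg m) fun g hg hg1 =>
    dual_posPart_apply_le m hg fun k hkg =>
      hk k hkg.1 ((norm_le_norm_of_le hkg.1 hkg.2).trans hg1)
  obtain ⟨y, hy⟩ := hE.exists_inclusionInDoubleDual_eq (x := ‖G‖ • x) (g := G - m⁺)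
    (fun g hg => sub_nonneg.2 (hmG g hg))
    (fun g hg => by
      have h1 := le_posPart m g hg
      change G g - m⁺ g ≤ inclusionInDoubleDual ℝ E (‖G‖ • x) g
      have h2 : m g = G g - inclusionInDoubleDual ℝ E (‖G‖ • x) g := rfl
      linarith)
  refine ⟨y, ?_⟩
  rw [hy]
  have h1 : G - (G - m⁺) = m⁺ := by
    ext k
    change G k - (G k - m⁺ k) = m⁺ k
    ring
  rw [h1]
  linarith

theorem OrderContinuousNorm.uawStarDual_subset [CompleteSpace E] [IsOrderedModule ℝ E]
    (hE : OrderContinuousNorm E) : uawStarDual E ⊆ canonicalImage E := by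
  intro F hF
  let G : StrongDual ℝ (StrongDual ℝ E) := ⟨F, hF.1⟩
  have hpart : ∀ ε : ℝ, 0 < ε → ∃ x : E, 0 ≤ x ∧
      ∀ g : StrongDual ℝ E, 0 ≤ g → ‖g‖ ≤ 1 → g x ≤ 1 → |G g| ≤ ε := fun ε hε => by
    obtain ⟨x, hx, h⟩ := exists_abs_apply_le_of_mem_uawStarDual hF hε
    exact ⟨x, hx, fun g hg hg1 hgx => h g hg1 (by rwa [abs_of_nonneg hg])⟩
  obtain ⟨y, hy⟩ := hE.mem_range_inclusionInDoubleDual (posPart_nonneg G) fun ε hε => by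
    obtain ⟨x, hx, h⟩ := hpart ε hε
    exact ⟨x, hx, fun g hg hg1 hgx => dual_posPart_apply_le G hg fun k hk =>
      (le_abs_self _).trans (h k hk.1 ((norm_le_norm_of_le hk.1 hk.2).trans hg1)
        ((hk.2 x hx).trans hgx))⟩
  obtain ⟨z, hz⟩ := hE.mem_range_inclusionInDoubleDual (posPart_nonneg (-G)) fun ε hε => by
    obtain ⟨x, hx, h⟩ := hpart ε hε
    exact ⟨x, hx, fun g hg hg1 hgx => dual_posPart_apply_le (-G) hg fun k hk =>
      (neg_le_abs _).trans (h k hk.1 ((norm_le_norm_of_le hk.1 hk.2).trans hg1)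
        ((hk.2 x hx).trans hgx))⟩
  refine ⟨y - z, ?_⟩
  replace hz : inclusionInDoubleDual ℝ E z = G⁻ := hz.trans (posPart_neg G)
  have h1 : inclusionInDoubleDual ℝ E (y - z) = G := by
    rw [map_sub, hy, hz]; exact posPart_sub_negPart G
  exact congrArg ContinuousLinearMap.toLinearMap h1

/-- If domination fails on `[0, x]`, each `p ≥ 0` has a bad `y p` with norming functional `g p`. The
net `(g p - p)⁺` is uaw*-null, but its value at `x` is at least `‖y p‖ - p (y p) > ε`. -/
theorem orderContinuousNorm_of_canonicalImage_subset [CompleteSpace E] [IsOrderedModule ℝ E]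
    (h : canonicalImage E ⊆ uawStarDual E) : OrderContinuousNorm E := by
  refine orderContinuousNorm_of_norm_le_apply_add fun x hx ε hε => ?_
  by_contra! hc
  choose y hy hlt using fun p : {p : StrongDual ℝ E // 0 ≤ p} => hc p.1 p.2
  choose g hg0 hg1 hgy using fun p => exists_nonneg_norming (hy p).1
  let c : {p : StrongDual ℝ E // 0 ≤ p} → StrongDual ℝ E := fun p => (g p - p.1)⁺
  have hc0 : ∀ p, 0 ≤ c p := fun p => posPart_nonneg _
  have hcg : ∀ p, c p ≤ g p := fun p => sup_le (sub_le_self _ p.2) (hg0 p)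
  have hnull : UawStarNull c := by
    intro w hw e
    have h0 : ∀ a, 0 ≤ |c a| ⊓ w := fun a => le_inf (abs_nonneg _) hw
    refine squeeze_zero_norm (fun a => ?_) (tendsto_zero_of_forall_natCast_smul_le
      hw (c := ‖e‖) (r := fun a => (|c a| ⊓ w) |e|)
      (fun a => dual_nonneg (h0 a) (abs_nonneg e)) fun n a hn ha => ?_)
    · have h1 := dual_abs_apply_le (|c a| ⊓ w) e
      rwa [abs_of_nonneg (h0 a)] at h1
    · have h1 : n • (|c a| ⊓ w) ≤ g a := by
        rw [abs_of_nonneg (hc0 a)]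
        refine (smul_le_smul_of_nonneg_left ?_ (zero_le_one.trans hn)).trans
          (smul_posPart_sub_inf_le (hg0 a) hn (w := w))
        exact inf_le_inf_right _ (posPart_mono (sub_le_sub_left ha _))
      exact (h1 _ (abs_nonneg e)).trans
        ((dual_apply_le_norm (hg1 a) _).trans_eq (norm_abs_eq_norm e))
  have hmem : (inclusionInDoubleDual ℝ E x).toLinearMap ∈ uawStarDual E := h ⟨x, rfl⟩
  have hlim := hmem.2 _ c ⟨1, fun p => (norm_le_norm_of_le (hc0 p) (hcg p)).trans (hg1 p)⟩ hnull
  have hε' : ε ≤ 0 := ge_of_tendsto' hlim fun p => by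
    have h1 : (g p - p.1) (y p) ≤ c p (y p) := le_posPart (g p - p.1) _ (hy p).1
    have h2 : c p (y p) ≤ c p x := dual_mono (hc0 p) (hy p).2
    have h3 : (g p - p.1) (y p) = ‖y p‖ - p.1 (y p) := by rw [← hgy p]; rfl
    change ε ≤ c p x
    linarith [hlt p]
  linarith

theorem OrderContinuousNorm.canonicalImage_subset [CompleteSpace E] [IsOrderedModule ℝ E]
    (hE : OrderContinuousNorm E) : canonicalImage E ⊆ uawStarDual E := by
  rintro _ ⟨x, rfl⟩
  refine ⟨(inclusionInDoubleDual ℝ E x).continuous, ?_⟩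
  intro ι _ _ _ g ⟨M, hM⟩ hg
  change Tendsto (fun a => g a x) atTop (𝓝 0)
  rw [Metric.tendsto_nhds]
  intro ε hε
  set M' := max M 1
  have hM' : 0 < M' := zero_lt_one.trans_le (le_max_right _ _)
  obtain ⟨p, hp, hpx⟩ := hE.exists_norm_le_apply_add (P := {p | 0 ≤ p}) (fun p hp => hp)
    (le_refl (0 : StrongDual ℝ E)) (fun p (hp : 0 ≤ p) q (hq : 0 ≤ q) => (add_nonneg hp hq : 0 ≤ p + q))
    (fun c hc p (hp : 0 ≤ p) => (smul_nonneg hc hp : 0 ≤ c • p))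
    (fun y hy c hc => by
      obtain ⟨f, hf, hf1, hfy⟩ := exists_nonneg_norming hy
      exact ⟨f, hf, hf1, by rwa [hfy]⟩) |x| (show 0 < ε / (2 * M') by positivity)
  have hp : 0 ≤ p := hp
  have hlim := hg (M' • p) (smul_nonneg hM'.le hp) |x|
  filter_upwards [hlim.eventually (gt_mem_nhds (show 0 < ε / 2 by positivity))] with a ha
  rw [Real.dist_eq, sub_zero]
  -- By Riesz-Kantorovich it is enough to bound `|g a| y - M' * p y` for `y ∈ [0, |x|]`, where `|g
  -- a| y ≤ M' * ‖y‖`.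
  have h1 : (|g a| - M' • p)⁺ |x| ≤ ε / 2 := by
    refine dual_posPart_apply_le _ (abs_nonneg x) fun y hy => ?_
    have h2 : |g a| y ≤ M' * ‖y‖ := (dual_abs_apply_le_norm (g a) hy.1).trans
      (mul_le_mul_of_nonneg_right ((hM a).trans (le_max_left _ _)) (norm_nonneg y))
    have h3 := mul_le_mul_of_nonneg_left (hpx y hy) hM'.le
    have h4 : M' * (ε / (2 * M')) = ε / 2 := by field_simp
    change |g a| y - M' * p y ≤ ε / 2
    rw [mul_add, h4] at h3
    linarith
  have h5 : |g a| |x| = (|g a| ⊓ M' • p) |x| + (|g a| - M' • p)⁺ |x| := by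
    rw [inf_eq_sub_posPart_sub, sub_apply, sub_add_cancel]
  linarith [dual_abs_apply_le (g a) x]

theorem orderContinuousNorm_iff_uawStarDual_eq [CompleteSpace E] [IsOrderedModule ℝ E] :
    OrderContinuousNorm E ↔ uawStarDual E = canonicalImage E :=
  ⟨fun h => h.uawStarDual_subset.antisymm h.canonicalImage_subset,
    fun h => orderContinuousNorm_of_canonicalImage_subset h.symm.subset⟩

end UawStar

/-! ### Disjoint vectors -/

section Disjoint

variable {E : Type u} [AddCommGroup E] [Lattice E] [IsOrderedAddMonoid E]

theorem inf_add_eq_zero {a b c : E} (ha : 0 ≤ a) (hb : 0 ≤ b) (hc : 0 ≤ c)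
    (hab : a ⊓ b = 0) (hac : a ⊓ c = 0) : a ⊓ (b + c) = 0 := by
  refine le_antisymm ?_ (le_inf ha (add_nonneg hb hc))
  have h1 : a ⊓ (b + c) - c ≤ 0 := by
    rw [← hab]
    exact le_inf ((sub_le_self _ hc).trans inf_le_left) (sub_le_iff_le_add.2 inf_le_right)
  rw [← hac]
  exact le_inf inf_le_left (sub_nonpos.1 h1)

/-- For disjoint positive vectors the sum is the supremum. -/
theorem sum_le_of_disjoint {ι : Type v} {z : ι → E} {w : E} (hz : ∀ i, 0 ≤ z i)
    (hzw : ∀ i, z i ≤ w) (hw : 0 ≤ w) (hd : ∀ i j, i ≠ j → z i ⊓ z j = 0) (s : Finset ι) :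
    ∑ i ∈ s, z i ≤ w := by
  classical
  induction s using Finset.induction_on with
  | empty => simpa using hw
  | insert i s his ih =>
    have hdis : ∀ t : Finset ι, i ∉ t → z i ⊓ ∑ j ∈ t, z j = 0 := fun t => by
      induction t using Finset.induction_on with
      | empty => intro _; simpa using hz i
      | insert j t hjt iht =>
        intro hi
        rw [Finset.mem_insert, not_or] at hi
        rw [Finset.sum_insert hjt]
        exact inf_add_eq_zero (hz i) (hz j) (Finset.sum_nonneg fun k _ => hz k) (hd i j hi.1)
          (iht hi.2)
    rw [Finset.sum_insert his, ← inf_add_sup, hdis s his, zero_add]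
    exact sup_le (hzw i) ih

end Disjoint

/-! ### Order continuity of the dual norm and the uaw, disjoint and un duals -/

section Duals

open NormedSpace (inclusionInDoubleDual)

variable {E : Type u} [NormedAddCommGroup E] [NormedSpace ℝ E] [Lattice E]
  [IsOrderedAddMonoid E] [HasSolidNorm E]

variable (E) in
/-- For every positive functional `f`, the unit ball of `E` is almost order bounded with respect
to the seminorm `x ↦ f |x|`. -/
def UnitBallAlmostOrderBounded : Prop :=
  ∀ f : StrongDual ℝ E, 0 ≤ f → ∀ ε : ℝ, 0 < ε →
    ∃ w : E, 0 ≤ w ∧ ∀ x : E, 0 ≤ x → ‖x‖ ≤ 1 → f (x - w)⁺ ≤ ε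

theorem UnitBallAlmostOrderBounded.orderContinuousNorm_dual (h : UnitBallAlmostOrderBounded E) :
    OrderContinuousNorm (StrongDual ℝ E) := by
  refine orderContinuousNorm_of_norm_le_apply_add fun f hf ε hε => ?_
  obtain ⟨w, hw, hfw⟩ := h f hf ε hε
  refine ⟨inclusionInDoubleDual ℝ E w, inclusionInDoubleDual_nonneg hw, fun g hg => ?_⟩
  refine dual_norm_le_of_nonneg hg.1 fun x hx hx1 => ?_
  have h1 := dual_mono hg.1 (le_posPart (x - w))
  have h2 := hg.2 _ (posPart_nonneg (x - w))
  have h3 := hfw x hx hx1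
  rw [map_sub] at h1
  change g x ≤ g w + ε
  linarith

variable [IsOrderedModule ℝ E]

/-- The domination criterion for `E'`, with the positive cone of `E` as norming cone, gives `‖k‖ ≤ k
w + ε` on `[0, f]`; taking `k` with `k (x - w) = f (x - w)⁺` concludes. -/
theorem unitBallAlmostOrderBounded_of_dual (h : OrderContinuousNorm (StrongDual ℝ E)) :
    UnitBallAlmostOrderBounded E := by
  intro f hf ε hε
  obtain ⟨_, ⟨w, hw, rfl⟩, hwf⟩ := h.exists_norm_le_apply_add
    (P := {p | ∃ w : E, 0 ≤ w ∧ inclusionInDoubleDual ℝ E w = p})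
    (by rintro _ ⟨w, hw, rfl⟩; exact inclusionInDoubleDual_nonneg hw)
    ⟨0, le_rfl, map_zero _⟩
    (by rintro _ ⟨w, hw, rfl⟩ _ ⟨z, hz, rfl⟩; exact ⟨w + z, add_nonneg hw hz, map_add _ _ _⟩)
    (by rintro c hc _ ⟨w, hw, rfl⟩; exact ⟨c • w, smul_nonneg hc hw, map_smul _ _ _⟩)
    (by
      intro g hg c hc
      obtain ⟨x, hx, hx1, hcx⟩ := exists_nonneg_lt_apply_of_lt_norm hg hc
      exact ⟨_, ⟨x, hx, rfl⟩, (NormedSpace.double_dual_bound ℝ E x).trans hx1, hcx⟩) f hε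
  refine ⟨w, hw, fun x hx hx1 => ?_⟩
  obtain ⟨k, hk, hkf, hkx⟩ := exists_dual_apply_eq_posPart hf (x - w)
  have h1 : ‖k‖ ≤ k w + ε := hwf k ⟨hk, hkf⟩
  have h2 : k x ≤ ‖k‖ := (Real.le_norm_self _).trans ((k.le_opNorm x).trans
    (mul_le_of_le_one_right (norm_nonneg k) hx1))
  rw [← hkx, map_sub]
  linarith

theorem UnitBallAlmostOrderBounded.tendsto (h : UnitBallAlmostOrderBounded E) {ι : Type v}
    [Preorder ι] {x : ι → E} (hb : NormBoundedNet x)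
    (hx : ∀ w : E, 0 ≤ w → ∀ g : StrongDual ℝ E, 0 ≤ g →
      Tendsto (fun a => g (|x a| ⊓ w)) atTop (𝓝 0)) (f : StrongDual ℝ E) :
    Tendsto (fun a => f (x a)) atTop (𝓝 0) := by
  obtain ⟨M, hM⟩ := hb
  set M' := max M 1
  have hM' : 0 < M' := zero_lt_one.trans_le (le_max_right _ _)
  rw [Metric.tendsto_nhds]
  intro ε hε
  obtain ⟨w, hw, hfw⟩ := h |f| (abs_nonneg f) (ε / (2 * M')) (by positivity)
  filter_upwards [(hx (M' • w) (smul_nonneg hM'.le hw) |f| (abs_nonneg f)).eventually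
    (gt_mem_nhds (show 0 < ε / 2 by positivity))] with a ha
  rw [Real.dist_eq, sub_zero]
  have h1 : |x a| - M' • w = M' • (M'⁻¹ • |x a| - w) := by
    rw [smul_sub, smul_inv_smul₀ hM'.ne']
  have h2 : |f| (|x a| - M' • w)⁺ ≤ ε / 2 := by
    rw [h1, posPart_smul_of_nonneg hM'.le, map_smul, smul_eq_mul]
    have h3 := hfw (M'⁻¹ • |x a|) (smul_nonneg (inv_nonneg.2 hM'.le) (abs_nonneg _)) (by
      rw [norm_smul, norm_inv, norm_abs_eq_norm, Real.norm_of_nonneg hM'.le,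
        inv_mul_le_iff₀ hM', mul_one]
      exact (hM a).trans (le_max_left _ _))
    have h4 := mul_le_mul_of_nonneg_left h3 hM'.le
    have h5 : M' * (ε / (2 * M')) = ε / 2 := by field_simp
    rwa [h5] at h4
  have h6 : |f| |x a| = |f| (|x a| ⊓ M' • w) + |f| (|x a| - M' • w)⁺ := by
    rw [inf_eq_sub_posPart_sub, map_sub, sub_add_cancel]
  linarith [dual_abs_apply_le f (x a)]

theorem UnNull.uawNull {ι : Type v} [Preorder ι] {x : ι → E} (hx : UnNull x) : UawNull x :=
  fun w hw f => by simpa [Function.comp_def] using (f.continuous.tendsto 0).comp (hx w hw)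

theorem uawDual_subset_unDual : uawDual E ⊆ unDual E :=
  fun _ hf => ⟨hf.1, fun ι _ _ _ x hb hx => hf.2 ι x hb hx.uawNull⟩

theorem unDual_subset_boundedDual : unDual E ⊆ boundedDual E := fun _ hf => hf.1

theorem dDual_subset_boundedDual : dDual E ⊆ boundedDual E := fun _ hf => hf.1

theorem UnitBallAlmostOrderBounded.boundedDual_subset_uawDual
    (h : UnitBallAlmostOrderBounded E) : boundedDual E ⊆ uawDual E :=
  fun f hf => ⟨hf, fun _ _ _ _ _ hb hx =>
    h.tendsto hb (fun w hw g _ => hx w hw g) (⟨f, hf⟩ : StrongDual ℝ E)⟩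

theorem DisjointNet.tendsto_inf {ι : Type v} [Preorder ι] [NoMaxOrder ι] {x : ι → E}
    (hx : DisjointNet x) {w : E} (hw : 0 ≤ w) {g : StrongDual ℝ E} (hg : 0 ≤ g) :
    Tendsto (fun a => g (|x a| ⊓ w)) atTop (𝓝 0) := by
  have h0 : ∀ a, 0 ≤ |x a| ⊓ w := fun a => le_inf (abs_nonneg _) hw
  rw [Metric.tendsto_nhds]
  intro ε hε
  -- Any `n` such indices give `n * ε ≤ g w`, by disjointness. A finite set of indices is eventually
  -- left behind because no index is maximal.
  have hfin : {a | ε ≤ g (|x a| ⊓ w)}.Finite := by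
    by_contra hinf
    obtain ⟨n, hn⟩ := exists_nat_gt (g w / ε)
    obtain ⟨s, hs, hsn⟩ := Set.Infinite.exists_subset_card_eq hinf n
    have h1 := dual_mono hg (sum_le_of_disjoint h0 (fun _ => inf_le_right) hw
      (fun a b hab => le_antisymm
        ((inf_le_inf inf_le_left inf_le_left).trans (hx a b hab).le)
        (le_inf (h0 a) (h0 b))) s)
    rw [map_sum] at h1
    have h2 := s.card_nsmul_le_sum (fun a => g (|x a| ⊓ w)) ε fun a ha => hs ha
    rw [hsn, nsmul_eq_mul] at h2
    rw [div_lt_iff₀ hε] at hn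
    linarith
  have hev : ∀ᶠ a in atTop, ∀ b ∈ {a | ε ≤ g (|x a| ⊓ w)}, a ≠ b := by
    refine (Filter.eventually_all_finite hfin).2 fun b _ => ?_
    filter_upwards [eventually_gt_atTop b] with a ha using ha.ne'
  filter_upwards [hev] with a ha
  rw [Real.dist_eq, sub_zero, abs_of_nonneg (dual_nonneg hg (h0 a))]
  by_contra! hc
  exact ha a hc rfl

theorem UnitBallAlmostOrderBounded.boundedDual_subset_dDual
    (h : UnitBallAlmostOrderBounded E) : boundedDual E ⊆ dDual E :=
  fun f hf => ⟨hf, fun _ _ _ _ _ _ hb hx =>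
    h.tendsto hb (fun _ hw _ hg => hx.tendsto_inf hw hg) (⟨f, hf⟩ : StrongDual ℝ E)⟩

/-- The un dual is the smallest useful hypothesis: the net `(x w - w)⁺` of counterexamples is even
un-null. -/
theorem unitBallAlmostOrderBounded_of_boundedDual_subset (h : boundedDual E ⊆ unDual E) :
    UnitBallAlmostOrderBounded E := by
  intro f hf ε hε
  by_contra! hc
  choose x hx hx1 hlt using fun w : {w : E // 0 ≤ w} => hc w.1 w.2
  let c : {w : E // 0 ≤ w} → E := fun w => (x w - w.1)⁺
  have hc0 : ∀ a, 0 ≤ c a := fun a => posPart_nonneg _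
  have hcx : ∀ a, c a ≤ x a := fun a => sup_le (sub_le_self _ a.2) (hx a)
  have hnull : UnNull c := by
    intro w hw
    have h0 : ∀ a, 0 ≤ |c a| ⊓ w := fun a => le_inf (abs_nonneg _) hw
    refine squeeze_zero_norm (fun a => le_rfl) (tendsto_zero_of_forall_natCast_smul_le
      hw (c := 1) (fun a => norm_nonneg _) fun n a hn ha => ?_)
    have hn0 : 0 ≤ n := zero_le_one.trans hn
    have h1 : n • (|c a| ⊓ w) ≤ x a := by
      rw [abs_of_nonneg (hc0 a)]
      refine (smul_le_smul_of_nonneg_left ?_ hn0).trans (smul_posPart_sub_inf_le (hx a) hn (w := w))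
      exact inf_le_inf_right _ (posPart_mono (sub_le_sub_left ha _))
    have h2 := norm_le_norm_of_le (smul_nonneg hn0 (h0 a)) h1
    rw [norm_smul, Real.norm_of_nonneg hn0] at h2
    exact h2.trans (hx1 a)
  have hmem : f.toLinearMap ∈ unDual E := h f.continuous
  have hlim := hmem.2 _ c ⟨1, fun a => (norm_le_norm_of_le (hc0 a) (hcx a)).trans (hx1 a)⟩ hnull
  have := ge_of_tendsto' hlim fun a => (hlt a).le
  linarith

theorem orderContinuousNorm_dual_iff : OrderContinuousNorm (StrongDual ℝ E) ↔
    uawDual E = dDual E ∧ dDual E = unDual E ∧ unDual E = boundedDual E := by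
  constructor
  · intro h
    have hK := unitBallAlmostOrderBounded_of_dual h
    have h1 : unDual E = boundedDual E := unDual_subset_boundedDual.antisymm
      (hK.boundedDual_subset_uawDual.trans uawDual_subset_unDual)
    have h2 : dDual E = boundedDual E :=
      dDual_subset_boundedDual.antisymm hK.boundedDual_subset_dDual
    have h3 : uawDual E = boundedDual E := Set.Subset.antisymm (fun f hf => hf.1)
      hK.boundedDual_subset_uawDual
    exact ⟨h3.trans h2.symm, h2.trans h1.symm, h1⟩
  · rintro ⟨-, -, h⟩
    exact (unitBallAlmostOrderBounded_of_boundedDual_subset h.symm.subset).orderContinuousNorm_dual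

/-! ### The unbounded order dual -/

theorem OrderContinuousNorm.tendsto_of_orderNull (hE : OrderContinuousNorm E) {ι : Type v}
    [Preorder ι] [IsDirectedOrder ι] [Nonempty ι] {x : ι → E} (hx : OrderNull x) :
    Tendsto x atTop (𝓝 0) := by
  obtain ⟨β, _, _, _, y, hy, hxy⟩ := hx
  rw [Metric.tendsto_nhds]
  intro ε hε
  obtain ⟨b, hb⟩ := ((hE β y hy).eventually (gt_mem_nhds hε)).exists
  obtain ⟨a₀, ha₀⟩ := hxy b
  filter_upwards [Ici_mem_atTop a₀] with a ha
  rw [dist_zero_right, ← norm_abs_eq_norm]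
  exact (norm_le_norm_of_le (abs_nonneg _) (ha₀ a ha)).trans_lt hb

theorem OrderContinuousNorm.boundedDual_subset_uoDual (hE : OrderContinuousNorm E)
    (h : UnitBallAlmostOrderBounded E) : boundedDual E ⊆ uoDual E := by
  intro f hf ι _ _ _ x hb hx
  refine h.tendsto hb (fun w hw g _ => ?_) (⟨f, hf⟩ : StrongDual ℝ E)
  simpa [Function.comp_def] using (g.continuous.tendsto 0).comp (hE.tendsto_of_orderNull (hx w hw))

theorem uoNull_of_abs_le {ι : Type v} [Preorder ι] {x : ι → E} {β : Type u} [Preorder β]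
    [IsDirectedOrder β] [Nonempty β] {y : β → E} (hy : DecreasesToZero y)
    (hxy : ∀ b, ∃ a₀, ∀ a ≥ a₀, |x a| ≤ y b) : UoNull x := by
  intro w hw
  refine ⟨β, inferInstance, inferInstance, inferInstance, y, hy, fun b => ?_⟩
  obtain ⟨a₀, ha₀⟩ := hxy b
  refine ⟨a₀, fun a ha => ?_⟩
  rw [abs_of_nonneg (le_inf (abs_nonneg _) hw)]
  exact inf_le_left.trans (ha₀ a ha)

theorem uoNull_of_norm_le_geometric [CompleteSpace E] {x : ULift.{u} ℕ → E}
    (hx : ∀ n, ‖x ⟨n⟩‖ ≤ (1 / 2) ^ n) : UoNull x := by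
  have hsum : Summable fun n : ℕ => |x ⟨n⟩| := Summable.of_norm_bounded
    (summable_geometric_of_lt_one (by norm_num) (by norm_num : (1 / 2 : ℝ) < 1))
    fun n => by rw [norm_abs_eq_norm]; exact hx n
  -- The tails of the absolutely convergent series dominate `|x n|` and decrease to zero.
  let z : ℕ → E := fun n => ∑' k, |x ⟨k + n⟩|
  have hz0 : ∀ n, 0 ≤ z n := fun n => tsum_nonneg fun k => abs_nonneg _
  have hrec : ∀ n, z n = |x ⟨n⟩| + z (n + 1) := fun n => by
    have h1 : Summable fun k : ℕ => |x ⟨k + n⟩| := (summable_nat_add_iff n).2 hsum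
    have h2 := h1.tsum_eq_zero_add
    simp only [zero_add] at h2
    refine h2.trans ?_
    congr 1
    exact tsum_congr fun k => by rw [add_assoc, add_comm 1]
  have hanti : Antitone z := antitone_nat_of_succ_le fun n => by
    rw [hrec n]; exact le_add_of_nonneg_left (abs_nonneg _)
  have hlim : Tendsto z atTop (𝓝 0) := tendsto_sum_nat_add fun n => |x ⟨n⟩|
  refine uoNull_of_abs_le (β := ULift.{u} ℕ) (y := fun n => z n.down)
    ⟨fun m n hmn => hanti hmn, ?_, ?_⟩ fun b => ⟨b, fun a ha => ?_⟩
  · rintro _ ⟨n, rfl⟩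
    exact hz0 _
  · intro c hc
    exact ge_of_tendsto' hlim fun n => hc ⟨⟨n⟩, rfl⟩
  · refine le_trans ?_ (hanti ha)
    rw [hrec a.down]
    exact le_add_of_nonneg_right (hz0 _)

/-- An unbounded `f` has vectors `v n` with `‖v n‖ ≤ 2 ^ (-n)` and `|f (v n)| = 1`, and such a
sequence is uo-null. -/
theorem uoDual_subset_boundedDual [CompleteSpace E] : uoDual E ⊆ boundedDual E := by
  intro f hf
  by_contra hcont
  have hunb : ∀ C : ℝ, ∃ x, C * ‖x‖ < ‖f x‖ := by
    by_contra! hc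
    obtain ⟨C, hC⟩ := hc
    exact hcont (AddMonoidHomClass.continuous_of_bound f C hC)
  choose x hx using fun n : ULift.{u} ℕ => hunb (2 ^ n.down)
  have hfx : ∀ n, 0 < ‖f (x n)‖ := fun n =>
    (mul_nonneg (by positivity) (norm_nonneg _)).trans_lt (hx n)
  let v : ULift.{u} ℕ → E := fun n => ‖f (x n)‖⁻¹ • x n
  have hv : ∀ n, ‖v n‖ ≤ (1 / 2) ^ n.down := fun n => by
    rw [norm_smul, norm_inv, norm_norm, inv_mul_le_iff₀ (hfx n), one_div, inv_pow,
      ← div_eq_mul_inv, le_div_iff₀ (by positivity), mul_comm]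
    exact (hx n).le
  have hfv : ∀ n, ‖f (v n)‖ = 1 := fun n => by
    rw [map_smul, norm_smul, norm_inv, norm_norm, inv_mul_cancel₀ (hfx n).ne']
  have hlim := hf (ULift.{u} ℕ) v
    ⟨1, fun n => (hv n).trans (pow_le_one₀ (by norm_num) (by norm_num))⟩
    (uoNull_of_norm_le_geometric fun n => hv ⟨n⟩)
  have := ge_of_tendsto' hlim.norm fun n => (hfv n).ge
  rw [norm_zero] at this
  linarith

theorem orderContinuousNorm_of_boundedDual_subset_uoDual (h : boundedDual E ⊆ uoDual E) :
    OrderContinuousNorm E := by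
  intro ι _ _ _ y hy
  obtain ⟨a₀⟩ := ‹Nonempty ι›
  have hy0 : ∀ a, 0 ≤ y a := fun a => hy.2.1 ⟨a, rfl⟩
  -- Passing to a tail makes the decreasing net norm bounded.
  let κ := {a : ι // a₀ ≤ a}
  have : Nonempty κ := ⟨⟨a₀, le_rfl⟩⟩
  have : IsDirectedOrder κ := ⟨fun a b => by
    obtain ⟨c, hac, hbc⟩ := exists_ge_ge a.1 b.1
    exact ⟨⟨c, a.2.trans hac⟩, hac, hbc⟩⟩
  let x : κ → E := fun a => y a.1
  have hanti : Antitone x := fun a b hab => hy.1 hab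
  have huo : UoNull x := by
    refine uoNull_of_abs_le (β := ι) hy fun b => ?_
    obtain ⟨c, hac, hbc⟩ := exists_ge_ge a₀ b
    refine ⟨⟨c, hac⟩, fun a ha => ?_⟩
    rw [abs_of_nonneg (hy0 _)]
    exact hy.1 (hbc.trans ha)
  have hw : WeaklyNull x := fun f =>
    h (show f.toLinearMap ∈ boundedDual E from f.continuous) κ x
      ⟨‖y a₀‖, fun a => norm_le_norm_of_le (hy0 _) (hy.1 a.2)⟩ huo
  have hlim := tendsto_norm_of_antitone_of_weaklyNull hanti (fun a => hy0 a.1) hw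
  rw [Metric.tendsto_nhds]
  intro ε hε
  obtain ⟨b, hb⟩ := (hlim.eventually (gt_mem_nhds hε)).exists
  filter_upwards [Ici_mem_atTop b.1] with a ha
  rw [dist_zero_right, norm_norm]
  exact (norm_le_norm_of_le (hy0 a) (hy.1 ha)).trans_lt hb

theorem orderContinuousNorm_and_dual_iff [CompleteSpace E] :
    (OrderContinuousNorm E ∧ OrderContinuousNorm (StrongDual ℝ E)) ↔
      uoDual E = uawDual E ∧ uawDual E = dDual E ∧ dDual E = unDual E ∧
        unDual E = boundedDual E := by
  constructor
  · rintro ⟨h, h'⟩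
    obtain ⟨h1, h2, h3⟩ := orderContinuousNorm_dual_iff.1 h'
    exact ⟨(uoDual_subset_boundedDual.antisymm (h.boundedDual_subset_uoDual
      (unitBallAlmostOrderBounded_of_dual h'))).trans (h1.trans (h2.trans h3)).symm, h1, h2, h3⟩
  · rintro ⟨h0, h1, h2, h3⟩
    exact ⟨orderContinuousNorm_of_boundedDual_subset_uoDual
      (h0.trans (h1.trans (h2.trans h3))).symm.subset, orderContinuousNorm_dual_iff.2 ⟨h1, h2, h3⟩⟩

end Duals

/-! ### Reflexivity -/

section Reflexive

open NormedSpace (inclusionInDoubleDual)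

variable {E : Type u} [NormedAddCommGroup E] [NormedSpace ℝ E]

theorem IsReflexiveSpace.dual (h : IsReflexiveSpace E) : IsReflexiveSpace (StrongDual ℝ E) := by
  intro Φ
  refine ⟨Φ.comp (inclusionInDoubleDual ℝ E), ContinuousLinearMap.ext fun g => ?_⟩
  obtain ⟨x, rfl⟩ := h g
  rfl

theorem isReflexiveSpace_iff : IsReflexiveSpace E ↔
    canonicalImage E = boundedDual (StrongDual ℝ E) := by
  constructor
  · intro h
    refine Set.Subset.antisymm ?_ fun F hF => ?_
    · rintro _ ⟨x, rfl⟩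
      exact (inclusionInDoubleDual ℝ E x).continuous
    · obtain ⟨x, hx⟩ := h ⟨F, hF⟩
      exact ⟨x, congrArg ContinuousLinearMap.toLinearMap hx⟩
  · intro h G
    obtain ⟨x, hx⟩ := h.symm.subset (show G.toLinearMap ∈ boundedDual _ from G.continuous)
    exact ⟨x, ContinuousLinearMap.coe_injective hx⟩

variable [Lattice E] [IsOrderedAddMonoid E] [IsOrderedModule ℝ E] [HasSolidNorm E]

/-- A decreasing positive net converges weak* in `E''`; by reflexivity the limit is a vector below
the net, hence `0`, so the net is weakly null and Dini applies. -/
theorem IsReflexiveSpace.orderContinuousNorm (h : IsReflexiveSpace E) :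
    OrderContinuousNorm E := by
  intro ι _ _ _ y hy
  have hy0 : ∀ a, 0 ≤ y a := fun a => hy.2.1 ⟨a, rfl⟩
  obtain ⟨G, hG0, hGy, hlim⟩ := exists_tendsto_of_antitone
    (φ := fun a => inclusionInDoubleDual ℝ E (y a))
    (fun a b hab => inclusionInDoubleDual_mono (hy.1 hab))
    (fun a => inclusionInDoubleDual_nonneg (hy0 a))
  obtain ⟨z, rfl⟩ := h G
  have hz : z = 0 := by
    refine le_antisymm (hy.2.2 ?_) (nonneg_of_forall_dual_nonneg hG0)
    rintro _ ⟨a, rfl⟩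
    exact inclusionInDoubleDual_le_iff.1 (hGy a)
  refine tendsto_norm_of_antitone_of_weaklyNull hy.1 hy0 fun f => ?_
  have hf := hlim f
  rwa [hz, map_zero] at hf

theorem isReflexiveSpace_iff_duals_eq [CompleteSpace E] : IsReflexiveSpace E ↔
    uawStarDual E = uoDual (StrongDual ℝ E) ∧
      uoDual (StrongDual ℝ E) = uawDual (StrongDual ℝ E) ∧
      uawDual (StrongDual ℝ E) = dDual (StrongDual ℝ E) ∧
      dDual (StrongDual ℝ E) = unDual (StrongDual ℝ E) ∧
      unDual (StrongDual ℝ E) = boundedDual (StrongDual ℝ E) := by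
  constructor
  · intro h
    obtain ⟨h0, h1, h2, h3⟩ := (orderContinuousNorm_and_dual_iff (E := StrongDual ℝ E)).1
      ⟨h.dual.orderContinuousNorm, h.dual.dual.orderContinuousNorm⟩
    refine ⟨?_, h0, h1, h2, h3⟩
    rw [orderContinuousNorm_iff_uawStarDual_eq.1 h.orderContinuousNorm, isReflexiveSpace_iff.1 h]
    exact (h0.trans (h1.trans (h2.trans h3))).symm
  · rintro ⟨h, h0, h1, h2, h3⟩
    have hall : uawStarDual E = boundedDual (StrongDual ℝ E) :=
      h.trans (h0.trans (h1.trans (h2.trans h3)))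
    have hE : OrderContinuousNorm E := orderContinuousNorm_of_canonicalImage_subset (by
      rw [hall]
      rintro _ ⟨x, rfl⟩
      exact (inclusionInDoubleDual ℝ E x).continuous)
    exact isReflexiveSpace_iff.2
      ((orderContinuousNorm_iff_uawStarDual_eq.1 hE).symm.trans hall)

end Reflexive

end

end BanachLattice

theorem mainTheorem8 (E : Type*) [NormedAddCommGroup E] [NormedSpace ℝ E] [CompleteSpace E]
    [Lattice E] [IsOrderedAddMonoid E] [IsOrderedModule ℝ E] [HasSolidNorm E] :
    (BanachLattice.OrderContinuousNorm E ↔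
      BanachLattice.uawStarDual E = BanachLattice.canonicalImage E) ∧
    (BanachLattice.OrderContinuousNorm (StrongDual ℝ E) ↔
      BanachLattice.uawDual E = BanachLattice.dDual E ∧
      BanachLattice.dDual E = BanachLattice.unDual E ∧
      BanachLattice.unDual E = BanachLattice.boundedDual E) ∧
    ((BanachLattice.OrderContinuousNorm E ∧
        BanachLattice.OrderContinuousNorm (StrongDual ℝ E)) ↔
      BanachLattice.uoDual E = BanachLattice.uawDual E ∧
      BanachLattice.uawDual E = BanachLattice.dDual E ∧
      BanachLattice.dDual E = BanachLattice.unDual E ∧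
      BanachLattice.unDual E = BanachLattice.boundedDual E) ∧
    (BanachLattice.IsReflexiveSpace E ↔
      BanachLattice.uawStarDual E = BanachLattice.uoDual (StrongDual ℝ E) ∧
      BanachLattice.uoDual (StrongDual ℝ E) = BanachLattice.uawDual (StrongDual ℝ E) ∧
      BanachLattice.uawDual (StrongDual ℝ E) = BanachLattice.dDual (StrongDual ℝ E) ∧
      BanachLattice.dDual (StrongDual ℝ E) = BanachLattice.unDual (StrongDual ℝ E) ∧
      BanachLattice.unDual (StrongDual ℝ E) =
        BanachLattice.boundedDual (StrongDual ℝ E)) :=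
  ⟨BanachLattice.orderContinuousNorm_iff_uawStarDual_eq,
    BanachLattice.orderContinuousNorm_dual_iff,
    BanachLattice.orderContinuousNorm_and_dual_iff,
    BanachLattice.isReflexiveSpace_iff_duals_eq⟩
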